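/- Let $V=\ell_2(\mathbb Z_{\ge 0})$ be the real Hilbert space with orthonormal basis $e_0,e_1,\dots$. A four-tensor is a real table $A=(A_{ijkl})_{i,j,k,l\ge 0}$, with $i,j,k,l$ on the right, top, left and bottom legs; $\|\cdot\|$ is the Hilbert–Schmidt norm $\|A\|=(\sum A_{ijkl}^2)^{1/2}$, and similarly for tensors with other legs. Let $A_*$ be the tensor whose only nonzero component is $(A_*)_{0000}=1$. *Assumptions.* $A$ satisfies **A1** (with parameter $\epsilon$) if $A_{0000}=1$ and $\|A-A_*\|=O(\epsilon)$. $A$ satisfies **A3** if $A_{0000}=1$ and $A=A_*+P+Q$ with $\|P\|=O(\epsilon)$, $\|Q\|=O(\epsilon^2)$, where the only nonzero components of the "one-circle" tensor $P$ are corner components, i.e. those in which exactly two indices are nonzero and these are on adjacent legs ($P_{ij00}$, $P_{0jk0}$, $P_{00kl}$, $P_{i00l}$ with the displayed letters $\neq 0$). *Type II step.* (1) Let $T$ be the contraction of a $2\times2$ block of copies of $A$; each of its four legs (right, top, left, bottom) carries a pair of indices, horizontal pairs being ordered top to bottom and vertical pairs left to right. (2) Given a bounded invertible $R$ on $V\otimes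 V$ (a disentangler), put $S=R^{-1}TR$, where $R^{-1}$ acts on the left and $R$ on the right pair of horizontal indices: $S_{r\,t\,l\,b}=\sum_{l',r'}(R^{-1})_{l l'}T_{r'\,t\,l'\,b}R_{r' r}$. (3) Write $S$ as the contraction over an internal bond $s$ of two half-discs: $S_{(r_1r_2)\,t\,(l_1l_2)\,b}=\sum_s (S_u)_{r_1\,t\,l_1\,s}\,(S_d)_{r_2\,s\,l_2\,b}$. (4) Contract in the opposite order: $U_{(r_1r_2)\,s\,(l_1l_2)\,s'}=\sum_{c}(S_d)_{r_1\,s\,l_1\,c}\,(S_u)_{r_2\,c\,l_2\,s'}$, where $c$ runs over pairs of vertical indices. (5) Identify the pairs of horizontal bonds with $V$ by an isometric isomorphism $J:V\to V\otimes V$ with $Je_0=e_0\otimes e_0$, and the internal bond space $W$ with $V$ by an isometric isomorphism $V\to W$ sending $e_0$ to the chosen unit vector of $W$ labelled $0$; the result is a four-tensor $A'$. **Proposition (type II RG step).** Suppose $A$ satisfies A3. Let $l=\sum_{i,j\ne0}l_{ij}\,e_i\otimes e_j$ and $r=\sum_{i,j\neq0}r_{ij}\,e_i\otimes e_j$ be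 the two "dangerous diagrams", $l_{ij}=\sum_{c\ne0}P_{00ic}P_{0cj0}$ and $r_{ij}=\sum_{c\neq 0}P_{i00c}P_{jc00}$, and let $B=|l\rangle\langle 00|-|00\rangle\langle r|$ on $V\otimes V$, where $|00\rangle=e_0\otimes e_0$. Then for all sufficiently small $\epsilon>0$: 1. $B=O(\epsilon^2)$, and the disentangler $R=\exp(B)$ cancels the $O(\epsilon^2)$ dangerous diagrams: the parts $(S_{00,00,ij,00})_{i,j\neq0}$ and $(S_{ij,00,00,00})_{i,j\ne0}$ of $S=R^{-1}TR$ have norm $O(\epsilon^3)$. 2. $S$ is the contraction of two half-discs $S_u,S_d$ over an internal bond space $W=W_0\oplus W_1\oplus\dots\oplus W_N$, where $N\ge 1$ is an absolute constant, $W_0$ is one-dimensional (spanned by the unit vector labelled $0$) and $W_1,\dots,W_N$ are infinite-dimensional with countable bases; the parts of $S_u,S_d$ with internal bond in $W_0$ are $O(1)$, and the parts with internal bond in $W_1\oplus\dots\oplus W_N$ are $O(\epsilon^{3/2})$. 3. For all isomorphisms as in (5), the result $A'$ of the type II step has $\mathcal N:=A'_{0000}=1+O(\epsilon^2)$, and $\mathcal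 N^{-1}A'$ satisfies A1 with $\epsilon$ replaced by $\epsilon^{3/2}$. All implied constants, and the bound on $\epsilon$, depend only on the constants implied in assumption A3. -/

import Mathlib

namespace TensorRG

/-! Tensors are tables of real numbers `T : ι → ℝ`, where `ι` is a product of the index sets of the
legs.  The indices of the legs of a four-tensor are always listed in the order
(right, top, left, bottom).  A pair of vertical bonds is listed as (left bond, right bond), a pair
of horizontal bonds as (top bond, bottom bond). -/

/-- The Hilbert-Schmidt norm of a table (meaningful when the squares are summable). -/
noncomputable def hsNorm {ι : Type} (T : ι → ℝ) : ℝ := √(∑' x, T x ^ 2)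

/-- `T` is a Hilbert-Schmidt tensor, and its norm is at most `c`. -/
def NormLE {ι : Type} (T : ι → ℝ) (c : ℝ) : Prop :=
  Summable (fun x => T x ^ 2) ∧ hsNorm T ≤ c

/-- The index set of a four-tensor with horizontal indices in `H` and vertical indices in `W`. -/
abbrev Four (H W : Type) : Type := H × W × H × W

/-- The high-temperature fixed point: the only nonzero component is `0000`, with value `1`. -/
def highTemp : Four ℕ ℕ → ℝ := fun x => if x = (0, 0, 0, 0) then 1 else 0

/-- Assumption A1, with `O(ε)` read as `≤ K ε`. -/
def SatisfiesA1 (K ε : ℝ) (A : Four ℕ ℕ → ℝ) : Prop :=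
  A (0, 0, 0, 0) = 1 ∧ NormLE (fun x => A x - highTemp x) (K * ε)

/-- Corner components: exactly two indices are nonzero, on two adjacent legs. -/
def IsCornerComponent : Four ℕ ℕ → Prop
  | (i, j, k, l) =>
    (i ≠ 0 ∧ j ≠ 0 ∧ k = 0 ∧ l = 0) ∨ (i = 0 ∧ j ≠ 0 ∧ k ≠ 0 ∧ l = 0) ∨
    (i = 0 ∧ j = 0 ∧ k ≠ 0 ∧ l ≠ 0) ∨ (i ≠ 0 ∧ j = 0 ∧ k = 0 ∧ l ≠ 0)

/-- `P` (the one-circle tensor) and `Q` (the two-circle tensor) show that `A` satisfies A3, with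
`O(ε)`, `O(ε²)` read as `≤ K ε`, `≤ K ε²`: `A` is normalized and is the sum of the high-temperature
tensor, of `P = O(ε)` all of whose nonzero components are corner components, and of `Q = O(ε²)`. -/
structure IsA3Decomposition (K ε : ℝ) (A P Q : Four ℕ ℕ → ℝ) : Prop where
  normalized : A (0, 0, 0, 0) = 1
  sum_eq : ∀ x, A x = highTemp x + P x + Q x
  one_circle : NormLE P (K * ε)
  two_circle : NormLE Q (K * ε ^ 2)
  corner : ∀ x, ¬ IsCornerComponent x → P x = 0

/-- The Hilbert space `ℓ²(ι)`.  Thus `L2 ℕ` is the bond space `V`, and `L2 (ℕ × ℕ)` is the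
Hilbert tensor product `V ⊗ V`. -/
abbrev L2 (ι : Type) : Type := lp (fun _ : ι => ℝ) 2

/-- The standard orthonormal basis of `ℓ²(ι)`. -/
noncomputable def basisVec {ι : Type} [DecidableEq ι] (i : ι) : L2 ι :=
  lp.single 2 i (1 : ℝ)

/-- The matrix element `⟨p| M |q⟩`. -/
noncomputable def matElem {ι : Type} [DecidableEq ι] (M : L2 ι →L[ℝ] L2 ι) (p q : ι) : ℝ :=
  M (basisVec q) p

/-- The `2 × 2` block of four copies of `A`; `a`, `a'` are the upper and lower internal horizontal
bonds, `c`, `c'` the left and right internal vertical bonds. -/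
noncomputable def blockTensor (A : Four ℕ ℕ → ℝ) : Four (ℕ × ℕ) (ℕ × ℕ) → ℝ
  | ((r₁, r₂), (t₁, t₂), (l₁, l₂), (b₁, b₂)) =>
    ∑' y : ℕ × ℕ × ℕ × ℕ,
      match y with
      | (a, a', c, c') =>
        A (a, t₁, l₁, c) * A (r₁, t₂, a, c') * A (a', c, l₂, b₁) * A (r₂, c', a', b₂)

/-- `S = R⁻¹ T R`: the disentangler acts on the pairs of horizontal indices of `T`, with `R⁻¹` on
the left and `R` on the right. -/
noncomputable def disentangle (R : L2 (ℕ × ℕ) ≃L[ℝ] L2 (ℕ × ℕ))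
    (T : Four (ℕ × ℕ) (ℕ × ℕ) → ℝ) : Four (ℕ × ℕ) (ℕ × ℕ) → ℝ
  | (r, t, l, b) =>
    ∑' y : (ℕ × ℕ) × (ℕ × ℕ),
      matElem (R.symm : L2 (ℕ × ℕ) →L[ℝ] L2 (ℕ × ℕ)) l y.1 * T (y.2, t, y.1, b) *
        matElem (R : L2 (ℕ × ℕ) →L[ℝ] L2 (ℕ × ℕ)) y.2 r

/-- The left dangerous diagram: two one-circle tensors on top of each other in the left column of
the block (all other bonds being `0`), joined by a vertical bond with a nonzero index; the left
legs carry the nonzero indices `i`, `j`. -/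
noncomputable def dangerLeft (P : Four ℕ ℕ → ℝ) : ℕ × ℕ → ℝ
  | (i, j) => if i ≠ 0 ∧ j ≠ 0 then ∑' c : ℕ, P (0, 0, i, c + 1) * P (0, c + 1, j, 0) else 0

/-- The right dangerous diagram, the reflection of the left one. -/
noncomputable def dangerRight (P : Four ℕ ℕ → ℝ) : ℕ × ℕ → ℝ
  | (i, j) => if i ≠ 0 ∧ j ≠ 0 then ∑' c : ℕ, P (i, 0, 0, c + 1) * P (j, c + 1, 0, 0) else 0

/-- `B = |l⟩⟨00| - |00⟩⟨r|` on `V ⊗ V`, where `l` and `r` are the left and the right dangerous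
diagram. -/
def IsDisentanglerGenerator (P : Four ℕ ℕ → ℝ) (B : L2 (ℕ × ℕ) →L[ℝ] L2 (ℕ × ℕ)) : Prop :=
  ∀ p q : ℕ × ℕ, matElem B p q =
    (if q = (0, 0) then dangerLeft P p else 0) - (if p = (0, 0) then dangerRight P q else 0)

/-- The basis of the internal bond space `W₀ ⊕ W₁ ⊕ ⋯ ⊕ W_N`: `none` spans the line `W₀`, and the
vectors `some (n, k)`, `k ∈ ℕ`, span the infinite-dimensional space `W_{n+1}`. -/
abbrev Bond (N : ℕ) : Type := Option (Fin N × ℕ)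

/-- The contraction of an upper half-disc (legs: right, top pair, left, internal bond) and a lower
half-disc (legs: right, internal bond, left, bottom pair) over the internal bond. -/
noncomputable def joinHalves {β : Type} (Su : ℕ × (ℕ × ℕ) × ℕ × β → ℝ)
    (Sd : ℕ × β × ℕ × (ℕ × ℕ) → ℝ) : Four (ℕ × ℕ) (ℕ × ℕ) → ℝ
  | ((r₁, r₂), t, (l₁, l₂), b) => ∑' s : β, Su (r₁, t, l₁, s) * Sd (r₂, s, l₂, b)

/-- The contraction in the opposite order, `Sd` above `Su`, over the pair of vertical bonds. -/
noncomputable def regroup {β : Type} (Su : ℕ × (ℕ × ℕ) × ℕ × β → ℝ)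
    (Sd : ℕ × β × ℕ × (ℕ × ℕ) → ℝ) : Four (ℕ × ℕ) β → ℝ
  | ((r₁, r₂), t, (l₁, l₂), b) =>
    ∑' c : ℕ × ℕ, Sd (r₁, t, l₁, c) * Su (r₂, c, l₂, b)

/-- The tensor on `V` obtained from `U` by contracting the pairs of horizontal legs with
`J : V ≅ V ⊗ V`, and identifying the internal bond space with `V` by `Φ`. -/
noncomputable def contractIso {β : Type} (J : L2 ℕ ≃ₗᵢ[ℝ] L2 (ℕ × ℕ)) (Φ : L2 ℕ ≃ₗᵢ[ℝ] L2 β)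
    (U : Four (ℕ × ℕ) β → ℝ) : Four ℕ ℕ → ℝ
  | (i, j, k, l) =>
    ∑' y : Four (ℕ × ℕ) β,
      U y * J (basisVec i) y.1 * Φ (basisVec j) y.2.1 * J (basisVec k) y.2.2.1 *
        Φ (basisVec l) y.2.2.2

end TensorRG

namespace TensorRG

/-! ### Tables with summable squares -/

section HilbertSchmidt

variable {ι κ α β γ : Type}

/-! Cut the block horizontally. It is the contraction `∑ g, u x g * v y g` of an upper row `u` and a
lower row `v` (a row of the reflected tensor) over the pair `g` of inner vertical bonds. By A3 a row
is the fixed point, plus a first-order part linear in `P`, plus a second-order part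
(`rowTensor_eq`). The term `g = (0, 0)` is a product table; it becomes the channel `W₀`. For `g ≠
(0, 0)` the fixed point drops out, and the corner condition reduces the first-order part to
`leftCorner` and `rightCorner`. Left corners pair only with left ones, right with right, and these
products are exactly the dangerous diagrams. Every other product contains a second-order factor, so
it is of third order (`nuclearLE_blockHalves_remainder`).

The remainder has to be split into two half-discs each of size `ε^(3/2)`. A Hilbert-Schmidt bound on
the remainder does not give this; a trace-norm bound across the horizontal cut does, because such a
table factors with the size shared equally. Hence the errors are carried by `NuclearLE`, which is
stable under sums and under contractions made separately in the upper and the lower half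
(`NuclearLE.contract`).

The vectors `l` and `r` are orthogonal to `|00⟩`, so `B ^ 3 = -ρ B` with `ρ = ⟨r, l⟩` of fourth
order, and `exp (±B) = 1 ± s B + k B ^ 2` exactly, with `s - 1 = O(ρ)`. Applied to the fixed-point
part of the block, the linear terms of `R` and `R⁻¹` give minus the dangerous diagrams up to higher
order; on the rest of the block, which is of first order, they give third-order errors
(`nuclearLE_disentangle`).

After regrouping, the contracted bond is the pair of outer vertical bonds. The first-order part of a
half-disc vanishes when that pair is `(0, 0)`, since `P` has no component with a single nonzero
index. It therefore never meets the fixed point, and contributes only at second order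
(`normLE_contract_perturbed`); the new channels contribute `O(ε^(3/2))`. The component `0000` sees
no new channel, so it is `1 + O(ε ^ 2)`. Isometries of the bonds do not increase the Hilbert-Schmidt
distance to the fixed point, by Bessel's inequality. -/

theorem normLE_iff_finset {T : ι → ℝ} {c : ℝ} :
    NormLE T c ↔ 0 ≤ c ∧ ∀ s : Finset ι, ∑ x ∈ s, T x ^ 2 ≤ c ^ 2 := by
  constructor
  · rintro ⟨hs, hc⟩
    have h0 : 0 ≤ c := (Real.sqrt_nonneg _).trans hc
    refine ⟨h0, fun s => (hs.sum_le_tsum s fun x _ => sq_nonneg _).trans ?_⟩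
    exact (Real.sqrt_le_left h0).1 hc
  · rintro ⟨h0, hs⟩
    refine ⟨summable_of_sum_le (fun x => sq_nonneg _) hs, ?_⟩
    exact (Real.sqrt_le_left h0).2 (Real.tsum_le_of_sum_le (fun x => sq_nonneg _) hs)

theorem NormLE.nonneg {T : ι → ℝ} {c : ℝ} (h : NormLE T c) : 0 ≤ c :=
  (normLE_iff_finset.1 h).1

theorem NormLE.tsum_sq_le {T : ι → ℝ} {c : ℝ} (h : NormLE T c) : ∑' x, T x ^ 2 ≤ c ^ 2 :=
  (Real.sqrt_le_left h.nonneg).1 h.2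

theorem NormLE.mono {T : ι → ℝ} {c d : ℝ} (h : NormLE T c) (hcd : c ≤ d) : NormLE T d :=
  ⟨h.1, h.2.trans hcd⟩

theorem NormLE.congr {T T' : ι → ℝ} {c : ℝ} (h : NormLE T c) (hT : ∀ x, T' x = T x) :
    NormLE T' c := by
  rwa [show T' = T from funext hT]

theorem NormLE.apply_le {T : ι → ℝ} {c : ℝ} (h : NormLE T c) (x : ι) : |T x| ≤ c := by
  have := (normLE_iff_finset.1 h).2 {x}
  rw [Finset.sum_singleton] at this
  exact abs_le_of_sq_le_sq this h.nonneg

theorem memℓp_two_of_summable {T : ι → ℝ} (h : Summable fun x => T x ^ 2) :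
    Memℓp (E := fun _ : ι => ℝ) T 2 := by
  rw [memℓp_gen_iff (by norm_num)]
  simpa using h

theorem normLE_coe_iff {f : L2 ι} {c : ℝ} : NormLE (fun x => f x) c ↔ ‖f‖ ≤ c := by
  have h1 : Summable fun x => f x ^ 2 := by
    have := (memℓp_gen_iff (E := fun _ : ι => ℝ) (p := 2) (by norm_num)).1 (lp.memℓp f)
    simpa using this
  have h2 : ‖f‖ ^ 2 = ∑' x, f x ^ 2 := by
    have := lp.norm_rpow_eq_tsum (E := fun _ : ι => ℝ) (p := 2) (by norm_num) f
    simpa using this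
  have h3 : hsNorm (fun x => f x) = ‖f‖ := by
    rw [hsNorm, ← h2, Real.sqrt_sq (norm_nonneg _)]
  simp [NormLE, h1, h3]

theorem NormLE.exists_L2 {T : ι → ℝ} {c : ℝ} (h : NormLE T c) :
    ∃ f : L2 ι, (∀ x, f x = T x) ∧ ‖f‖ ≤ c :=
  ⟨⟨T, memℓp_two_of_summable h.1⟩, fun _ => rfl, normLE_coe_iff.1 h⟩

theorem NormLE.add {T S : ι → ℝ} {c d : ℝ} (hT : NormLE T c) (hS : NormLE S d) :
    NormLE (fun x => T x + S x) (c + d) := by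
  obtain ⟨f, hf, hfc⟩ := hT.exists_L2
  obtain ⟨g, hg, hgd⟩ := hS.exists_L2
  refine (normLE_coe_iff.2 ((norm_add_le f g).trans (add_le_add hfc hgd))).congr fun x => ?_
  simp [hf, hg]

theorem NormLE.const_mul {T : ι → ℝ} {c t d : ℝ} (hT : NormLE T c) (ht : |t| ≤ d) :
    NormLE (fun x => t * T x) (d * c) := by
  obtain ⟨f, hf, hfc⟩ := hT.exists_L2
  refine ((normLE_coe_iff (f := t • f)).2 ?_).congr fun x => ?_
  · rw [norm_smul, Real.norm_eq_abs]
    exact mul_le_mul ht hfc (norm_nonneg _) ((abs_nonneg _).trans ht)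
  · simp [hf]

theorem NormLE.abs {T : ι → ℝ} {c : ℝ} (hT : NormLE T c) : NormLE (fun x => |T x|) c := by
  rw [normLE_iff_finset] at hT ⊢
  simpa using hT

/-- A table dominated, on a set and along a map which is injective there, by another table, and
vanishing elsewhere. -/
theorem NormLE.of_injOn {E : κ → ℝ} {F : ι → ℝ} {c : ℝ} (hE : NormLE E c) (g : ι → κ)
    (s : Set ι) (hg : s.InjOn g) (h : ∀ x ∈ s, |F x| ≤ |E (g x)|) (h0 : ∀ x ∉ s, F x = 0) :
    NormLE F c := by
  classical
  rw [normLE_iff_finset] at hE ⊢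
  refine ⟨hE.1, fun t => ?_⟩
  calc ∑ x ∈ t, F x ^ 2 = ∑ x ∈ t with x ∈ s, F x ^ 2 := by
        rw [Finset.sum_filter_of_ne]
        intro x _ hx
        by_contra hxs
        exact hx (by simp [h0 x hxs])
    _ ≤ ∑ x ∈ t with x ∈ s, E (g x) ^ 2 :=
        Finset.sum_le_sum fun x hx => sq_le_sq.2 (h x (Finset.mem_filter.1 hx).2)
    _ = ∑ y ∈ Finset.image g {x ∈ t | x ∈ s}, E y ^ 2 := by
        rw [Finset.sum_image]
        intro x hx y hy hxy
        exact hg (Finset.mem_filter.1 hx).2 (Finset.mem_filter.1 hy).2 hxy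
    _ ≤ c ^ 2 := hE.2 _

theorem NormLE.comp {E : κ → ℝ} {c : ℝ} (hE : NormLE E c) {g : ι → κ}
    (hg : Function.Injective g) : NormLE (fun x => E (g x)) c :=
  hE.of_injOn g Set.univ hg.injOn (fun _ _ => le_rfl) (by simp)

/-- A table which is dominated entrywise. -/
theorem NormLE.of_abs_le {E F : ι → ℝ} {c : ℝ} (hE : NormLE E c) (h : ∀ x, |F x| ≤ |E x|) :
    NormLE F c :=
  hE.of_injOn id Set.univ Function.injective_id.injOn (fun x _ => h x) (by simp)

theorem normLE_indicator (p : ι → Prop) [DecidablePred p] (hp : ∀ x y, p x → p y → x = y) :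
    NormLE (fun x => if p x then (1 : ℝ) else 0) 1 := by
  have h : NormLE (fun _ : Unit => (1 : ℝ)) 1 := by
    rw [normLE_iff_finset]
    refine ⟨zero_le_one, fun s => ?_⟩
    have := Finset.card_le_univ s
    simpa using this
  refine h.of_injOn (fun _ => ()) {x | p x} (fun x hx y hy _ => hp x y hx hy) ?_ ?_
  · intro x hx
    simp_all
  · intro x hx
    simp_all

theorem NormLE.mul {E : ι → ℝ} {F : κ → ℝ} {c d : ℝ} (hE : NormLE E c) (hF : NormLE F d) :
    NormLE (fun p : ι × κ => E p.1 * F p.2) (c * d) := by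
  classical
  rw [normLE_iff_finset] at hE hF ⊢
  refine ⟨mul_nonneg hE.1 hF.1, fun s => ?_⟩
  calc ∑ p ∈ s, (E p.1 * F p.2) ^ 2
      ≤ ∑ p ∈ s.image Prod.fst ×ˢ s.image Prod.snd, (E p.1 * F p.2) ^ 2 :=
        Finset.sum_le_sum_of_subset_of_nonneg Finset.subset_product fun _ _ _ => sq_nonneg _
    _ = (∑ x ∈ s.image Prod.fst, E x ^ 2) * ∑ y ∈ s.image Prod.snd, F y ^ 2 := by
        rw [Finset.sum_mul_sum, Finset.sum_product]
        simp only [mul_pow]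
    _ ≤ (c * d) ^ 2 := by
        rw [mul_pow]
        exact mul_le_mul (hE.2 _) (hF.2 _) (Finset.sum_nonneg fun _ _ => sq_nonneg _)
          (sq_nonneg _)

theorem summable_mul_of_sq {f g : ι → ℝ} (hf : Summable fun x => f x ^ 2)
    (hg : Summable fun x => g x ^ 2) : Summable fun x => f x * g x := by
  refine Summable.of_norm_bounded (hf.add hg) fun x => ?_
  rw [Real.norm_eq_abs, abs_mul, ← sq_abs (f x), ← sq_abs (g x)]
  nlinarith [sq_nonneg (|f x| - |g x|), abs_nonneg (f x), abs_nonneg (g x)]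

theorem tsum_mul_sq_le {f g : ι → ℝ} (hf : Summable fun x => f x ^ 2)
    (hg : Summable fun x => g x ^ 2) :
    (∑' x, f x * g x) ^ 2 ≤ (∑' x, f x ^ 2) * ∑' x, g x ^ 2 := by
  have h := real_inner_mul_inner_self_le (F := L2 ι) ⟨f, memℓp_two_of_summable hf⟩
    ⟨g, memℓp_two_of_summable hg⟩
  simp only [lp.inner_eq_tsum, RCLike.inner_apply] at h
  simpa [pow_two, mul_comm] using h

/-- The part of a table with fixed value of the first index. -/
theorem NormLE.row_summable {E : α → γ → ℝ} {c : ℝ}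
    (hE : NormLE (fun p : α × γ => E p.1 p.2) c) (x : α) : Summable fun z => E x z ^ 2 :=
  (hE.comp (g := fun z => (x, z)) (fun _ _ h => (Prod.mk.inj h).2)).1

theorem NormLE.summable_contract {E : α → γ → ℝ} {F : β → γ → ℝ} {c d : ℝ}
    (hE : NormLE (fun p : α × γ => E p.1 p.2) c) (hF : NormLE (fun p : β × γ => F p.1 p.2) d)
    (x : α) (y : β) : Summable fun z => E x z * F y z :=
  summable_mul_of_sq (hE.row_summable x) (hF.row_summable y)

/-- The Hilbert-Schmidt norm of a contraction over one common bond. -/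
theorem NormLE.contract {E : α → γ → ℝ} {F : β → γ → ℝ} {c d : ℝ}
    (hE : NormLE (fun p : α × γ => E p.1 p.2) c) (hF : NormLE (fun p : β × γ => F p.1 p.2) d) :
    NormLE (fun p : α × β => ∑' z, E p.1 z * F p.2 z) (c * d) := by
  -- The norms of the rows of a table form a vector whose norm is that of the table. By
  -- Cauchy-Schwarz, an entry of the contraction is at most the product of two row norms.
  have key : ∀ {δ : Type} {G : δ → γ → ℝ} {e : ℝ}, NormLE (fun p : δ × γ => G p.1 p.2) e →
      NormLE (fun x : δ => √(∑' z, G x z ^ 2)) e := by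
    intro δ G e hG
    have hs := hG.1
    refine ⟨?_, ?_⟩
    · have := hs.prod
      refine this.congr fun x => ?_
      rw [Real.sq_sqrt (tsum_nonneg fun _ => sq_nonneg _)]
    · refine le_trans (le_of_eq ?_) hG.2
      unfold hsNorm
      rw [hs.tsum_prod]
      congr 1
      refine tsum_congr fun x => ?_
      rw [Real.sq_sqrt (tsum_nonneg fun _ => sq_nonneg _)]
  refine ((key hE).mul (key hF)).of_abs_le fun p => ?_
  refine sq_le_sq.1 ?_
  rw [mul_pow, Real.sq_sqrt (tsum_nonneg fun _ => sq_nonneg _),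
    Real.sq_sqrt (tsum_nonneg fun _ => sq_nonneg _)]
  exact tsum_mul_sq_le (hE.row_summable _) (hF.row_summable _)

/-- A contraction over `α` and `β`, followed by one over `γ`, converges absolutely. -/
theorem summable_triple {p : γ → α → ℝ} {q : γ → β → ℝ} (hp : ∀ z, Summable fun a => |p z a|)
    (hq : ∀ z, Summable fun b => |q z b|) (hp2 : Summable fun z => (∑' a, |p z a|) ^ 2)
    (hq2 : Summable fun z => (∑' b, |q z b|) ^ 2) :
    Summable fun y : γ × α × β => p y.1 y.2.1 * q y.1 y.2.2 := by
  rw [← summable_abs_iff]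
  have h1 : ∀ z, Summable fun y : α × β => |p z y.1| * |q z y.2| := fun z =>
    (hp z).mul_of_nonneg (hq z) (fun _ => abs_nonneg _) fun _ => abs_nonneg _
  simp only [abs_mul]
  rw [summable_prod_of_nonneg fun _ => mul_nonneg (abs_nonneg _) (abs_nonneg _)]
  refine ⟨h1, (summable_mul_of_sq hp2 hq2).congr fun z => ?_⟩
  exact (hp z).tsum_mul_tsum (hq z) (h1 z)

theorem tsum_triple {p : γ → α → ℝ} {q : γ → β → ℝ} (hp : ∀ z, Summable fun a => |p z a|)
    (hq : ∀ z, Summable fun b => |q z b|) (hp2 : Summable fun z => (∑' a, |p z a|) ^ 2)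
    (hq2 : Summable fun z => (∑' b, |q z b|) ^ 2) :
    ∑' y : γ × α × β, p y.1 y.2.1 * q y.1 y.2.2 = ∑' z, (∑' a, p z a) * ∑' b, q z b := by
  have h := summable_triple hp hq hp2 hq2
  rw [h.tsum_prod]
  refine tsum_congr fun z => ?_
  exact ((hp z).of_abs.tsum_mul_tsum (hq z).of_abs (h.prod_factor z)).symm

/-- Fubini for the order in which the inner bond `γ` is summed first; it is what makes contraction
of nuclear tables compatible with their factorizations. -/
theorem tsum_triple' {p : γ → α → ℝ} {q : γ → β → ℝ} (hp : ∀ z, Summable fun a => |p z a|)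
    (hq : ∀ z, Summable fun b => |q z b|) (hp2 : Summable fun z => (∑' a, |p z a|) ^ 2)
    (hq2 : Summable fun z => (∑' b, |q z b|) ^ 2) :
    ∑' y : α × β, ∑' z, p z y.1 * q z y.2 = ∑' z, (∑' a, p z a) * ∑' b, q z b := by
  have h := summable_triple hp hq hp2 hq2
  rw [← tsum_triple hp hq hp2 hq2, h.tsum_prod]
  exact (Summable.tsum_comm (f := fun (y : α × β) z => p z y.1 * q z y.2)
    ((Equiv.prodComm _ _).summable_iff.1 h)).symm

end HilbertSchmidt


/-! ### Nuclear tables -/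

section Nuclear

variable {X Y X' Y' Z Z' γ δ : Type}

/-- `F` is a contraction, over a countable bond, of two Hilbert-Schmidt tables of norm at most
`√c`.  In other words, the trace norm of `F`, as an operator from `ℓ²(Y)` to `ℓ²(X)`, is at most
`c`. -/
def NuclearLE (F : X → Y → ℝ) (c : ℝ) : Prop :=
  0 < c ∧ ∃ (γ : Type) (_ : Countable γ) (u : X → γ → ℝ) (v : Y → γ → ℝ),
    NormLE (fun p : X × γ => u p.1 p.2) √c ∧ NormLE (fun p : Y × γ => v p.1 p.2) √c ∧
    ∀ x y, F x y = ∑' z, u x z * v y z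

/-- Squared norms add over a disjoint union of bonds. With bounds written as square roots, this is
what makes the trace norm subadditive with no loss of constant. -/
theorem NormLE.sum {u : X → γ → ℝ} {v : X → δ → ℝ} {a b : ℝ} (ha : 0 ≤ a) (hb : 0 ≤ b)
    (hu : NormLE (fun p : X × γ => u p.1 p.2) √a) (hv : NormLE (fun p : X × δ => v p.1 p.2) √b) :
    NormLE (fun p : X × (γ ⊕ δ) => Sum.elim (u p.1) (v p.1) p.2) √(a + b) := by
  have h : HasSum (Sum.elim (fun p : X × γ => u p.1 p.2 ^ 2) fun p : X × δ => v p.1 p.2 ^ 2)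
      (∑' p : X × γ, u p.1 p.2 ^ 2 + ∑' p : X × δ, v p.1 p.2 ^ 2) :=
    HasSum.sum (by exact hu.1.hasSum) (by exact hv.1.hasSum)
  rw [← (Equiv.prodSumDistrib X γ δ).hasSum_iff] at h
  have h' : HasSum (fun p : X × (γ ⊕ δ) => Sum.elim (u p.1) (v p.1) p.2 ^ 2)
      (∑' p : X × γ, u p.1 p.2 ^ 2 + ∑' p : X × δ, v p.1 p.2 ^ 2) := by
    convert h using 1
    ext ⟨x, z | z⟩ <;> rfl
  refine ⟨h'.summable, ?_⟩
  unfold hsNorm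
  rw [h'.tsum_eq]
  refine Real.sqrt_le_sqrt (add_le_add ?_ ?_)
  · simpa [Real.sq_sqrt ha] using hu.tsum_sq_le
  · simpa [Real.sq_sqrt hb] using hv.tsum_sq_le

theorem NuclearLE.congr {F G : X → Y → ℝ} {c : ℝ} (h : NuclearLE F c)
    (hG : ∀ x y, G x y = F x y) : NuclearLE G c := by
  rwa [show G = F from funext fun x => funext (hG x)]

theorem NuclearLE.mono {F : X → Y → ℝ} {c d : ℝ} (h : NuclearLE F c) (hcd : c ≤ d) :
    NuclearLE F d := by
  obtain ⟨hc, γ, hγ, u, v, hu, hv, hF⟩ := h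
  exact ⟨hc.trans_le hcd, γ, hγ, u, v, hu.mono (Real.sqrt_le_sqrt hcd),
    hv.mono (Real.sqrt_le_sqrt hcd), hF⟩

/-- The two factors can be rescaled to have the same norm. -/
theorem nuclearLE_contract [Countable γ] {u : X → γ → ℝ} {v : Y → γ → ℝ} {a b : ℝ} (ha : 0 < a)
    (hb : 0 < b) (hu : NormLE (fun p : X × γ => u p.1 p.2) a)
    (hv : NormLE (fun p : Y × γ => v p.1 p.2) b) :
    NuclearLE (fun x y => ∑' z, u x z * v y z) (a * b) := by
  have hsa := Real.sqrt_pos.2 ha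
  have hsb := Real.sqrt_pos.2 hb
  refine ⟨mul_pos ha hb, γ, ‹_›, fun x z => √b / √a * u x z, fun y z => √a / √b * v y z, ?_, ?_, ?_⟩
  · refine (hu.const_mul (le_of_eq (abs_of_pos (div_pos hsb hsa)))).mono (le_of_eq ?_)
    rw [Real.sqrt_mul ha.le]
    nth_rewrite 2 [← Real.mul_self_sqrt ha.le]
    field_simp
  · refine (hv.const_mul (le_of_eq (abs_of_pos (div_pos hsa hsb)))).mono (le_of_eq ?_)
    rw [Real.sqrt_mul ha.le]
    nth_rewrite 2 [← Real.mul_self_sqrt hb.le]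
    field_simp
  · intro x y
    refine tsum_congr fun z => ?_
    field_simp

theorem nuclearLE_mul {u : X → ℝ} {v : Y → ℝ} {a b : ℝ} (ha : 0 < a) (hb : 0 < b)
    (hu : NormLE u a) (hv : NormLE v b) : NuclearLE (fun x y => u x * v y) (a * b) := by
  have := nuclearLE_contract (γ := Unit) (u := fun x _ => u x) (v := fun y _ => v y) ha hb
    (hu.comp (g := Prod.fst) fun p q h => Prod.ext h rfl)
    (hv.comp (g := Prod.fst) fun p q h => Prod.ext h rfl)
  simpa using this

theorem NuclearLE.normLE {F : X → Y → ℝ} {c : ℝ} (h : NuclearLE F c) :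
    NormLE (fun p : X × Y => F p.1 p.2) c := by
  obtain ⟨hc, γ, hγ, u, v, hu, hv, hF⟩ := h
  have := hu.contract hv
  rw [Real.mul_self_sqrt hc.le] at this
  exact this.congr fun p => hF _ _

theorem NuclearLE.comp {F : X → Y → ℝ} {c : ℝ} (h : NuclearLE F c) {f : X' → X} {g : Y' → Y}
    (hf : Function.Injective f) (hg : Function.Injective g) :
    NuclearLE (fun x y => F (f x) (g y)) c := by
  obtain ⟨hc, γ, hγ, u, v, hu, hv, hF⟩ := h
  exact ⟨hc, γ, hγ, fun x z => u (f x) z, fun y z => v (g y) z,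
    by exact hu.comp (g := Prod.map f id) (hf.prodMap Function.injective_id),
    by exact hv.comp (g := Prod.map g id) (hg.prodMap Function.injective_id), fun x y => hF _ _⟩

/-- The bond of the sum is the disjoint union of the two bonds. -/
theorem NuclearLE.add {F G : X → Y → ℝ} {c d : ℝ} (hF : NuclearLE F c) (hG : NuclearLE G d) :
    NuclearLE (fun x y => F x y + G x y) (c + d) := by
  obtain ⟨hc, γ, hγ, u, v, hu, hv, hF⟩ := hF
  obtain ⟨hd, δ, hδ, u', v', hu', hv', hG⟩ := hG
  refine ⟨add_pos hc hd, γ ⊕ δ, inferInstance, fun x => Sum.elim (u x) (u' x),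
    fun y => Sum.elim (v y) (v' y), NormLE.sum hc.le hd.le hu hu',
    NormLE.sum hc.le hd.le hv hv', ?_⟩
  intro x y
  have h1 := (hu.summable_contract hv x y).hasSum
  have h2 := (hu'.summable_contract hv' x y).hasSum
  simp only [hF, hG]
  exact (HasSum.sum (f := fun z : γ ⊕ δ => Sum.elim (u x) (u' x) z * Sum.elim (v y) (v' y) z)
    h1 h2).tsum_eq.symm

theorem NuclearLE.const_mul {F : X → Y → ℝ} {c t d : ℝ} (hF : NuclearLE F c) (ht : |t| ≤ d)
    (hd : 0 < d) : NuclearLE (fun x y => t * F x y) (d * c) := by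
  obtain ⟨hc, γ, hγ, u, v, hu, hv, hF⟩ := hF
  have hsc := Real.sqrt_pos.2 hc
  have := nuclearLE_contract (u := fun x z => t * u x z) (v := v) (mul_pos hd hsc) hsc
    (hu.const_mul ht) hv
  rw [mul_assoc, Real.mul_self_sqrt hc.le] at this
  refine this.congr fun x y => ?_
  rw [hF, ← tsum_mul_left]
  simp only [mul_assoc]

/-- The contraction of two nuclear tables over a bond of `X`-type legs and one of `Y`-type legs. -/
theorem NuclearLE.contract {M : X' × Z → Y' × Z' → ℝ} {F : X × Z → Y × Z' → ℝ} {a b : ℝ}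
    (hM : NuclearLE M a) (hF : NuclearLE F b) :
    NuclearLE (fun (x : X × X') (y : Y × Y') =>
      ∑' z : Z × Z', M (x.2, z.1) (y.2, z.2) * F (x.1, z.1) (y.1, z.2)) (a * b) := by
  obtain ⟨ha, γ, hγ, mu, md, hmu, hmd, hM⟩ := hM
  obtain ⟨hb, δ, hδ, fu, fd, hfu, hfd, hF⟩ := hF
  have hsa := Real.sqrt_pos.2 ha
  have hsb := Real.sqrt_pos.2 hb
  -- The upper factors are contracted with each other, and so are the lower ones; the product has
  -- the bond `γ × δ`.
  have shuffle : ∀ {A B C : Type} {m : B × C → γ → ℝ} {f : A × C → δ → ℝ},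
      NormLE (fun p : (B × C) × γ => m p.1 p.2) √a →
      NormLE (fun p : (A × C) × δ => f p.1 p.2) √b →
      NormLE (fun p : (A × B) × (γ × δ) =>
        ∑' z, m (p.1.2, z) p.2.1 * f (p.1.1, z) p.2.2) (√a * √b) := by
    intro A B C m f hm hf
    have := NormLE.contract (α := B × γ) (β := A × δ) (γ := C)
      (E := fun x z => m (x.1, z) x.2) (F := fun x z => f (x.1, z) x.2)
      (hm.comp (g := fun p : (B × γ) × C => ((p.1.1, p.2), p.1.2))
        (by rintro ⟨⟨_, _⟩, _⟩ ⟨⟨_, _⟩, _⟩ h; simp_all))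
      (hf.comp (g := fun p : (A × δ) × C => ((p.1.1, p.2), p.1.2))
        (by rintro ⟨⟨_, _⟩, _⟩ ⟨⟨_, _⟩, _⟩ h; simp_all))
    exact this.comp (g := fun p : (A × B) × (γ × δ) => ((p.1.2, p.2.1), (p.1.1, p.2.2)))
      (by rintro ⟨⟨_, _⟩, ⟨_, _⟩⟩ ⟨⟨_, _⟩, ⟨_, _⟩⟩ h; simp_all)
  have hu := shuffle (m := mu) (f := fu) hmu hfu
  have hv := shuffle (m := md) (f := fd) hmd hfd
  -- The same bounds for absolute values give the absolute convergence needed to interchange the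
  -- sums.
  have hu' := shuffle (m := fun x z => |mu x z|) (f := fun x z => |fu x z|) hmu.abs hfu.abs
  have hv' := shuffle (m := fun x z => |md x z|) (f := fun x z => |fd x z|) hmd.abs hfd.abs
  have key := nuclearLE_contract
    (u := fun (x : X × X') (c : γ × δ) => ∑' z, mu (x.2, z) c.1 * fu (x.1, z) c.2)
    (v := fun (y : Y × Y') (c : γ × δ) => ∑' z, md (y.2, z) c.1 * fd (y.1, z) c.2)
    (mul_pos hsa hsb) (mul_pos hsa hsb) hu hv
  have hab : √a * √b * (√a * √b) = a * b := by
    rw [mul_mul_mul_comm, Real.mul_self_sqrt ha.le, Real.mul_self_sqrt hb.le]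
  rw [hab] at key
  refine key.congr ?_
  rintro ⟨x, x'⟩ ⟨y, y'⟩
  have summ : ∀ {A B C : Type} {m : B × C → γ → ℝ} {f : A × C → δ → ℝ},
      NormLE (fun p : (B × C) × γ => m p.1 p.2) √a →
      NormLE (fun p : (A × C) × δ => f p.1 p.2) √b → ∀ (i : A) (j : B) (c : γ × δ),
      Summable fun z => |m (j, z) c.1 * f (i, z) c.2| := by
    intro A B C m f hm hf i j c
    refine (summable_mul_of_sq ?_ ?_).abs
    · exact (hm.comp (g := fun z : C => ((j, z), c.1)) (by intro _ _ h; simp_all)).1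
    · exact (hf.comp (g := fun z : C => ((i, z), c.2)) (by intro _ _ h; simp_all)).1
  have fub := tsum_triple' (γ := γ × δ) (α := Z) (β := Z')
    (p := fun c z => mu (x', z) c.1 * fu (x, z) c.2)
    (q := fun c z => md (y', z) c.1 * fd (y, z) c.2)
    (summ hmu hfu x x') (summ hmd hfd y y')
    (by simpa only [abs_mul] using (hu'.row_summable (E := fun (x : X × X') (c : γ × δ) =>
      ∑' z, |mu (x.2, z) c.1| * |fu (x.1, z) c.2|) (x, x')))
    (by simpa only [abs_mul] using (hv'.row_summable (E := fun (y : Y × Y') (c : γ × δ) =>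
      ∑' z, |md (y.2, z) c.1| * |fd (y.1, z) c.2|) (y, y')))
  simp only
  rw [← fub]
  refine tsum_congr fun z => ?_
  rw [hM, hF]
  have s1 := hmu.summable_contract hmd (x', z.1) (y', z.2)
  have s2 := hfu.summable_contract hfd (x, z.1) (y, z.2)
  rw [tsum_mul_tsum_of_summable_norm s1.norm s2.norm]
  refine tsum_congr fun c => ?_
  ring

/-- The tensor product is the contraction over one-dimensional bonds. -/
theorem NuclearLE.mul {M : X' → Y' → ℝ} {F : X → Y → ℝ} {a b : ℝ}
    (hM : NuclearLE M a) (hF : NuclearLE F b) :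
    NuclearLE (fun (x : X × X') (y : Y × Y') => M x.2 y.2 * F x.1 y.1) (a * b) := by
  have h1 : NuclearLE (fun (x : X' × Unit) (y : Y' × Unit) => M x.1 y.1) a :=
    hM.comp (f := Prod.fst) (g := Prod.fst) (fun p q h => Prod.ext h rfl)
      fun p q h => Prod.ext h rfl
  have h2 : NuclearLE (fun (x : X × Unit) (y : Y × Unit) => F x.1 y.1) b :=
    hF.comp (f := Prod.fst) (g := Prod.fst) (fun p q h => Prod.ext h rfl)
      fun p q h => Prod.ext h rfl
  refine (h1.contract h2).congr fun x y => ?_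
  rw [tsum_fintype]
  simp

/-- The bond can be taken to be any countably infinite type. -/
theorem NuclearLE.exists_bond {F : X → Y → ℝ} {c : ℝ} (h : NuclearLE F c) (β : Type)
    [Countable β] [Infinite β] :
    ∃ (u : X → β → ℝ) (v : Y → β → ℝ),
      NormLE (fun p : X × β => u p.1 p.2) √c ∧ NormLE (fun p : Y × β => v p.1 p.2) √c ∧
      ∀ x y, F x y = ∑' z, u x z * v y z := by
  obtain ⟨hc, γ, hγ, u, v, hu, hv, hF⟩ := h
  -- The given bond may be finite. Padding it by zeros along `β` makes it countably infinite, hence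
  -- in bijection with `β`.
  obtain ⟨i⟩ := nonempty_denumerable (γ ⊕ β)
  obtain ⟨j⟩ := nonempty_denumerable β
  obtain ⟨e⟩ : Nonempty (β ≃ γ ⊕ β) :=
    ⟨(Denumerable.eqv β).trans (Denumerable.eqv (γ ⊕ β)).symm⟩
  have ext : ∀ {A : Type} {w : A → γ → ℝ}, NormLE (fun p : A × γ => w p.1 p.2) √c →
      NormLE (fun p : A × β => Sum.elim (w p.1) (fun _ => (0 : ℝ)) (e p.2)) √c := by
    intro A w hw
    have h0 : NormLE (fun p : A × β => (fun _ _ => (0 : ℝ) : A → β → ℝ) p.1 p.2) √0 :=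
      normLE_iff_finset.2 ⟨Real.sqrt_nonneg _, by simp⟩
    have := NormLE.sum (u := w) (v := fun _ _ => 0) hc.le le_rfl hw h0
    rw [add_zero] at this
    exact this.comp (g := fun p : A × β => (p.1, e p.2))
      (by rintro ⟨_, _⟩ ⟨_, _⟩ h; simp_all)
  refine ⟨fun x z => Sum.elim (u x) (fun _ => 0) (e z),
    fun y z => Sum.elim (v y) (fun _ => 0) (e z), ext hu, ext hv, fun x y => ?_⟩
  have h1 := (hu.summable_contract (E := u) (F := v) hv x y).hasSum
  have h2 : HasSum (fun z : γ ⊕ β => Sum.elim (u x) (fun _ => 0) z * Sum.elim (v y) (fun _ => 0) z)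
      (∑' z, u x z * v y z + 0) := by
    refine HasSum.sum h1 ?_
    simp [Function.comp_def]
  rw [hF, ← add_zero (∑' z, u x z * v y z), ← h2.tsum_eq]
  exact (e.tsum_eq (fun z => Sum.elim (u x) (fun _ => 0) z * Sum.elim (v y) (fun _ => 0) z)).symm

end Nuclear


/-! ### The rows of the block -/

/-- Legs (right, pair of vertical bonds, left) of a half of a four-tensor with doubled legs. -/
abbrev HalfLegs : Type := ℕ × (ℕ × ℕ) × ℕ

/-- The reflection exchanging top and bottom. -/
def flipVert (A : Four ℕ ℕ → ℝ) : Four ℕ ℕ → ℝ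
  | (i, j, k, l) => A (i, l, k, j)

/-- The contraction of two four-tensors side by side. -/
noncomputable def rowTensor (E F : Four ℕ ℕ → ℝ) (x : HalfLegs) (g : ℕ × ℕ) : ℝ :=
  ∑' a, E (a, x.2.1.1, x.2.2, g.1) * F (x.1, x.2.1.2, a, g.2)

/-- The row with `E` on the left and the fixed point on the right. -/
def leftPart (E : Four ℕ ℕ → ℝ) (x : HalfLegs) (g : ℕ × ℕ) : ℝ :=
  if x.1 = 0 ∧ x.2.1.2 = 0 ∧ g.2 = 0 then E (0, x.2.1.1, x.2.2, g.1) else 0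

/-- The row with `E` on the right and the fixed point on the left. -/
def rightPart (E : Four ℕ ℕ → ℝ) (x : HalfLegs) (g : ℕ × ℕ) : ℝ :=
  if x.2.2 = 0 ∧ x.2.1.1 = 0 ∧ g.1 = 0 then E (x.1, x.2.1.2, 0, g.2) else 0

/-- The row of the fixed point. -/
def rowDelta (x : HalfLegs) (g : ℕ × ℕ) : ℝ :=
  if x = (0, (0, 0), 0) ∧ g = (0, 0) then 1 else 0

/-- The part of `leftPart` that enters the left dangerous diagram. -/
def leftCorner (P : Four ℕ ℕ → ℝ) (x : HalfLegs) (g : ℕ × ℕ) : ℝ :=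
  if x.1 = 0 ∧ x.2.1 = (0, 0) ∧ g.2 = 0 then P (0, 0, x.2.2, g.1) else 0

/-- The part of `rightPart` that enters the right dangerous diagram. -/
def rightCorner (P : Four ℕ ℕ → ℝ) (x : HalfLegs) (g : ℕ × ℕ) : ℝ :=
  if x.2.2 = 0 ∧ x.2.1 = (0, 0) ∧ g.1 = 0 then P (x.1, 0, 0, g.2) else 0

/-- The first-order part of the row. -/
def rowFirst (P : Four ℕ ℕ → ℝ) (x : HalfLegs) (g : ℕ × ℕ) : ℝ :=
  leftPart P x g + rightPart P x g

/-- The second-order part of the row. -/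
noncomputable def rowSecond (P Q : Four ℕ ℕ → ℝ) (x : HalfLegs) (g : ℕ × ℕ) : ℝ :=
  rowTensor (fun z => P z + Q z) (fun z => P z + Q z) x g + leftPart Q x g + rightPart Q x g

variable {E F A P Q : Four ℕ ℕ → ℝ} {η : ℝ}

theorem normLE_flipVert {c : ℝ} (h : NormLE E c) : NormLE (flipVert E) c := by
  refine (h.comp (g := fun z : Four ℕ ℕ => (z.1, z.2.2.2, z.2.2.1, z.2.1)) ?_).congr fun z => rfl
  rintro ⟨_, _, _, _⟩ ⟨_, _, _, _⟩ h
  simp_all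

theorem IsA3Decomposition.flipVert {K ε : ℝ} (h : IsA3Decomposition K ε A P Q) :
    IsA3Decomposition K ε (flipVert A) (flipVert P) (flipVert Q) where
  normalized := h.normalized
  sum_eq := by
    rintro ⟨i, j, k, l⟩
    simp only [TensorRG.flipVert, h.sum_eq, highTemp, Prod.mk.injEq]
    congr 3
    exact propext (by tauto)
  one_circle := normLE_flipVert h.one_circle
  two_circle := normLE_flipVert h.two_circle
  corner := by
    rintro ⟨i, j, k, l⟩ hc
    refine h.corner _ fun h' => hc ?_
    simp only [IsCornerComponent] at h' ⊢
    tauto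

theorem normLE_leftPart {c : ℝ} (h : NormLE E c) :
    NormLE (fun p : HalfLegs × ℕ × ℕ => leftPart E p.1 p.2) c := by
  refine h.of_injOn (fun p => (0, p.1.2.1.1, p.1.2.2, p.2.1))
    {p | p.1.1 = 0 ∧ p.1.2.1.2 = 0 ∧ p.2.2 = 0} ?_ ?_ ?_
  · rintro ⟨⟨_, ⟨_, _⟩, _⟩, _, _⟩ h ⟨⟨_, ⟨_, _⟩, _⟩, _, _⟩ h' hh
    simp_all
  · intro p hp
    simp [leftPart, if_pos (show _ ∧ _ ∧ _ from hp)]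
  · intro p hp
    exact if_neg hp

theorem normLE_rightPart {c : ℝ} (h : NormLE E c) :
    NormLE (fun p : HalfLegs × ℕ × ℕ => rightPart E p.1 p.2) c := by
  refine h.of_injOn (fun p => (p.1.1, p.1.2.1.2, 0, p.2.2))
    {p | p.1.2.2 = 0 ∧ p.1.2.1.1 = 0 ∧ p.2.1 = 0} ?_ ?_ ?_
  · rintro ⟨⟨_, ⟨_, _⟩, _⟩, _, _⟩ h ⟨⟨_, ⟨_, _⟩, _⟩, _, _⟩ h' hh
    simp_all
  · intro p hp
    simp [rightPart, if_pos (show _ ∧ _ ∧ _ from hp)]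
  · intro p hp
    exact if_neg hp

theorem normLE_leftCorner {c : ℝ} (h : NormLE P c) :
    NormLE (fun p : HalfLegs × ℕ × ℕ => leftCorner P p.1 p.2) c := by
  refine (normLE_leftPart h).of_abs_le fun p => ?_
  rcases p with ⟨⟨r, ⟨t₁, t₂⟩, l⟩, g⟩
  by_cases hp : r = 0 ∧ (t₁, t₂) = (0, 0) ∧ g.2 = 0
  · obtain ⟨rfl, ht, hg⟩ := hp
    simp_all [leftCorner, leftPart]
  · rw [leftCorner, if_neg hp, abs_zero]
    exact abs_nonneg _

theorem normLE_rightCorner {c : ℝ} (h : NormLE P c) :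
    NormLE (fun p : HalfLegs × ℕ × ℕ => rightCorner P p.1 p.2) c := by
  refine (normLE_rightPart h).of_abs_le fun p => ?_
  rcases p with ⟨⟨r, ⟨t₁, t₂⟩, l⟩, g⟩
  by_cases hp : l = 0 ∧ (t₁, t₂) = (0, 0) ∧ g.1 = 0
  · obtain ⟨rfl, ht, hg⟩ := hp
    simp_all [rightCorner, rightPart]
  · rw [rightCorner, if_neg hp, abs_zero]
    exact abs_nonneg _

theorem normLE_rowDelta : NormLE (fun p : HalfLegs × ℕ × ℕ => rowDelta p.1 p.2) 1 :=
  normLE_indicator (fun p : HalfLegs × ℕ × ℕ => p.1 = (0, (0, 0), 0) ∧ p.2 = (0, 0))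
    fun _ _ h h' => Prod.ext (h.1.trans h'.1.symm) (h.2.trans h'.2.symm)

/-- The right tensor of a row, as a table with separated contracted bond. -/
theorem normLE_rowRight {d : ℝ} (hF : NormLE F d) :
    NormLE (fun p : (ℕ × ℕ × ℕ) × ℕ => F (p.1.1, p.1.2.1, p.2, p.1.2.2)) d :=
  hF.comp (g := fun p : (ℕ × ℕ × ℕ) × ℕ => (p.1.1, p.1.2.1, p.2, p.1.2.2))
    (by rintro ⟨⟨_, _, _⟩, _⟩ ⟨⟨_, _, _⟩, _⟩ h; simp_all)

/-- The left tensor of a row, as a table with separated contracted bond. -/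
theorem normLE_rowLeft {c : ℝ} (hE : NormLE E c) :
    NormLE (fun p : (ℕ × ℕ × ℕ) × ℕ => E (p.2, p.1.1, p.1.2.1, p.1.2.2)) c :=
  hE.comp (g := fun p : (ℕ × ℕ × ℕ) × ℕ => (p.2, p.1.1, p.1.2.1, p.1.2.2))
    (by rintro ⟨⟨_, _, _⟩, _⟩ ⟨⟨_, _, _⟩, _⟩ h; simp_all)

theorem summable_rowTensor {c d : ℝ} (hE : NormLE E c) (hF : NormLE F d) (x : HalfLegs)
    (g : ℕ × ℕ) :
    Summable fun a => E (a, x.2.1.1, x.2.2, g.1) * F (x.1, x.2.1.2, a, g.2) :=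
  NormLE.summable_contract (E := fun (i : ℕ × ℕ × ℕ) a => E (a, i.1, i.2.1, i.2.2))
    (F := fun (i : ℕ × ℕ × ℕ) a => F (i.1, i.2.1, a, i.2.2))
    (normLE_rowLeft hE) (normLE_rowRight hF) (x.2.1.1, x.2.2, g.1) (x.1, x.2.1.2, g.2)

theorem normLE_rowTensor {c d : ℝ} (hE : NormLE E c) (hF : NormLE F d) :
    NormLE (fun p : HalfLegs × ℕ × ℕ => rowTensor E F p.1 p.2) (c * d) := by
  have := NormLE.contract (E := fun (i : ℕ × ℕ × ℕ) a => E (a, i.1, i.2.1, i.2.2))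
    (F := fun (i : ℕ × ℕ × ℕ) a => F (i.1, i.2.1, a, i.2.2))
    (normLE_rowLeft hE) (normLE_rowRight hF)
  exact this.comp (g := fun p : HalfLegs × ℕ × ℕ =>
      ((p.1.2.1.1, p.1.2.2, p.2.1), (p.1.1, p.1.2.1.2, p.2.2)))
    (by rintro ⟨⟨_, ⟨_, _⟩, _⟩, _, _⟩ ⟨⟨_, ⟨_, _⟩, _⟩, _, _⟩ h; simp_all)

/-- The block is the contraction of its two rows. -/
theorem blockTensor_eq {c : ℝ} (hA : NormLE A c) (x y : HalfLegs) :
    blockTensor A ((x.1, y.1), x.2.1, (x.2.2, y.2.2), y.2.1) =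
      ∑' g, rowTensor A A x g * rowTensor (flipVert A) (flipVert A) y g := by
  have hA' := normLE_flipVert hA
  have sq : ∀ {E : Four ℕ ℕ → ℝ}, NormLE E c → ∀ x : HalfLegs, Summable fun g : ℕ × ℕ =>
      (∑' a, |E (a, x.2.1.1, x.2.2, g.1) * E (x.1, x.2.1.2, a, g.2)|) ^ 2 := by
    intro E hE x
    have := (normLE_rowTensor hE.abs hE.abs).row_summable
      (E := fun x g => rowTensor (fun z => |E z|) (fun z => |E z|) x g) x
    simpa only [rowTensor, ← abs_mul] using this
  have h := tsum_triple
    (p := fun (g : ℕ × ℕ) a => A (a, x.2.1.1, x.2.2, g.1) * A (x.1, x.2.1.2, a, g.2))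
    (q := fun (g : ℕ × ℕ) a => flipVert A (a, y.2.1.1, y.2.2, g.1) *
      flipVert A (y.1, y.2.1.2, a, g.2))
    (fun g => (summable_rowTensor hA hA x g).abs) (fun g => (summable_rowTensor hA' hA' y g).abs)
    (sq hA x) (sq hA' y)
  refine Eq.trans ?_ h
  let e : ℕ × ℕ × ℕ × ℕ ≃ (ℕ × ℕ) × ℕ × ℕ :=
    { toFun := fun z => ((z.2.2.1, z.2.2.2), z.1, z.2.1)
      invFun := fun z => (z.2.1, z.2.2, z.1.1, z.1.2)
      left_inv := fun _ => rfl
      right_inv := fun _ => rfl }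
  rw [← e.tsum_eq]
  refine tsum_congr fun z => ?_
  simp only [flipVert, e, Equiv.coe_fn_mk]
  ring

theorem IsA3Decomposition.normLE_add (h : IsA3Decomposition 1 η A P Q) (h0 : 0 < η)
    (h1 : η ≤ 1) : NormLE (fun z => P z + Q z) (2 * η) :=
  (h.one_circle.add h.two_circle).mono (by nlinarith)

theorem normLE_highTemp : NormLE highTemp 1 :=
  normLE_indicator (fun z : Four ℕ ℕ => z = (0, 0, 0, 0)) fun _ _ h h' => h.trans h'.symm

theorem IsA3Decomposition.normLE (h : IsA3Decomposition 1 η A P Q) (h0 : 0 < η)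
    (h1 : η ≤ 1) : NormLE A 3 :=
  ((normLE_highTemp.add (h.normLE_add h0 h1)).mono (by linarith)).congr fun z => by
    rw [h.sum_eq]; ring

/-- Write `A` as the fixed point plus `P + Q` and expand. A fixed-point factor forces the contracted
horizontal index to be `0`, so the mixed terms are `leftPart` and `rightPart` of `P + Q`; only the
product of the two perturbations keeps a genuine sum. -/
theorem rowTensor_eq (h : IsA3Decomposition 1 η A P Q) (h0 : 0 < η) (h1 : η ≤ 1) (x : HalfLegs)
    (g : ℕ × ℕ) : rowTensor A A x g = rowDelta x g + rowFirst P x g + rowSecond P Q x g := by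
  have hH := h.normLE_add h0 h1
  set H : Four ℕ ℕ → ℝ := fun z => P z + Q z with hHdef
  have hA : ∀ z, A z = highTemp z + H z := fun z => by rw [h.sum_eq, hHdef]; ring
  have s1 := summable_rowTensor hH hH x g
  have s2 := hasSum_single (f := fun a => highTemp (a, x.2.1.1, x.2.2, g.1) *
      highTemp (x.1, x.2.1.2, a, g.2) +
      highTemp (a, x.2.1.1, x.2.2, g.1) * H (x.1, x.2.1.2, a, g.2) +
      H (a, x.2.1.1, x.2.2, g.1) * highTemp (x.1, x.2.1.2, a, g.2)) 0
    fun a ha => by simp [highTemp, ha]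
  have s3 := s2.add s1.hasSum
  refine ((tsum_congr fun a => ?_).trans s3.tsum_eq).trans ?_
  · rw [hA, hA]
    ring
  rw [rowSecond, rowFirst]
  change _ + rowTensor H H x g = _
  obtain ⟨r, ⟨t₁, t₂⟩, l⟩ := x
  obtain ⟨g₁, g₂⟩ := g
  simp only [rowDelta, leftPart, rightPart, highTemp, Prod.mk.injEq, hHdef]
  by_cases c1 : r = 0 ∧ t₂ = 0 ∧ g₂ = 0 <;> by_cases c2 : l = 0 ∧ t₁ = 0 ∧ g₁ = 0
  · obtain ⟨rfl, rfl, rfl⟩ := c1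
    obtain ⟨rfl, rfl, rfl⟩ := c2
    simp
    ring
  · have c2' : ¬ (t₁ = 0 ∧ l = 0 ∧ g₁ = 0) := by tauto
    obtain ⟨rfl, rfl, rfl⟩ := c1
    have c3 : ¬ ((t₁ = 0 ∧ l = 0) ∧ g₁ = 0) := by tauto
    simp [c2, c2', c3]
    ring
  · have c1' : ¬ (r = 0 ∧ t₂ = 0 ∧ True ∧ g₂ = 0) := by tauto
    obtain ⟨rfl, rfl, rfl⟩ := c2
    have c3 : ¬ ((r = 0 ∧ t₂ = 0) ∧ g₂ = 0) := by tauto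
    simp [c1, c3]
    ring
  · have c2' : ¬ (t₁ = 0 ∧ l = 0 ∧ g₁ = 0) := by tauto
    have c3 : ¬ ((r = 0 ∧ (t₁ = 0 ∧ t₂ = 0) ∧ l = 0) ∧ g₁ = 0 ∧ g₂ = 0) := by tauto
    simp [c1, c2, c2', c3]

/-! ### Size and support of the parts of a row. -/

theorem normLE_rowFirst (h : IsA3Decomposition 1 η A P Q) :
    NormLE (fun p : HalfLegs × ℕ × ℕ => rowFirst P p.1 p.2) (2 * η) :=
  ((normLE_leftPart h.one_circle).add (normLE_rightPart h.one_circle)).mono (by linarith)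

theorem normLE_corners (h : IsA3Decomposition 1 η A P Q) :
    NormLE (fun p : HalfLegs × ℕ × ℕ => leftCorner P p.1 p.2 + rightCorner P p.1 p.2) (2 * η) :=
  ((normLE_leftCorner h.one_circle).add (normLE_rightCorner h.one_circle)).mono (by linarith)

theorem normLE_rowSecond (h : IsA3Decomposition 1 η A P Q) (h0 : 0 < η) (h1 : η ≤ 1) :
    NormLE (fun p : HalfLegs × ℕ × ℕ => rowSecond P Q p.1 p.2) (6 * η ^ 2) := by
  have hH := h.normLE_add h0 h1
  exact (((normLE_rowTensor hH hH).add (normLE_leftPart h.two_circle)).add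
    (normLE_rightPart h.two_circle)).mono (by nlinarith)

theorem normLE_row_sub (h : IsA3Decomposition 1 η A P Q) (h0 : 0 < η) (h1 : η ≤ 1) :
    NormLE (fun p : HalfLegs × ℕ × ℕ => rowTensor A A p.1 p.2 - rowDelta p.1 p.2) (8 * η) :=
  (((normLE_rowFirst h).add (normLE_rowSecond h h0 h1)).mono (by nlinarith)).congr fun p => by
    rw [rowTensor_eq h h0 h1]; ring

theorem normLE_row (h : IsA3Decomposition 1 η A P Q) (h0 : 0 < η) (h1 : η ≤ 1) :
    NormLE (fun p : HalfLegs × ℕ × ℕ => rowTensor A A p.1 p.2) 9 :=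
  ((normLE_rowDelta.add (normLE_row_sub h h0 h1)).mono (by linarith)).congr fun p => by ring

/-- A nonzero inner vertical index sits on a bottom leg. A corner component then has its other
nonzero index on a horizontal leg, so the opposite top leg must carry `0`. -/
theorem rowFirst_of_ne (h : IsA3Decomposition 1 η A P Q) (x : HalfLegs) {g : ℕ × ℕ}
    (hg : g ≠ (0, 0)) : rowFirst P x g = leftCorner P x g + rightCorner P x g := by
  obtain ⟨r, ⟨t₁, t₂⟩, l⟩ := x
  obtain ⟨g₁, g₂⟩ := g
  have hg' : ¬ (g₁ = 0 ∧ g₂ = 0) := by simpa using hg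
  simp only [rowFirst, leftPart, rightPart, leftCorner, rightCorner, Prod.mk.injEq]
  congr 1
  · by_cases c : r = 0 ∧ t₂ = 0 ∧ g₂ = 0
    · obtain ⟨rfl, rfl, rfl⟩ := c
      by_cases ht : t₁ = 0
      · simp [ht]
      · simp only [ht, and_self, if_true, false_and, and_false, if_false]
        refine h.corner _ ?_
        simp only [IsCornerComponent]
        tauto
    · rw [if_neg c, if_neg (by tauto)]
  · by_cases c : l = 0 ∧ t₁ = 0 ∧ g₁ = 0
    · obtain ⟨rfl, rfl, rfl⟩ := c
      by_cases ht : t₂ = 0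
      · simp [ht]
      · simp only [ht, and_self, if_true, false_and, and_false, if_false]
        refine h.corner _ ?_
        simp only [IsCornerComponent]
        tauto
    · rw [if_neg c, if_neg (by tauto)]

theorem leftCorner_zero (h : IsA3Decomposition 1 η A P Q) (x : HalfLegs) :
    leftCorner P x (0, 0) = 0 := by
  unfold leftCorner
  split_ifs
  · exact h.corner _ (by simp [IsCornerComponent])
  · rfl

theorem rightCorner_zero (h : IsA3Decomposition 1 η A P Q) (x : HalfLegs) :
    rightCorner P x (0, 0) = 0 := by
  unfold rightCorner
  split_ifs
  · exact h.corner _ (by simp [IsCornerComponent])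
  · rfl

/-- Only components of `P` with at most one nonzero index occur here. This vanishing is used twice:
for the size of the dangerous components of the product term, and for the absence of a linear term
after regrouping. -/
theorem rowFirst_zero (h : IsA3Decomposition 1 η A P Q) (r l : ℕ) :
    rowFirst P (r, (0, 0), l) (0, 0) = 0 := by
  unfold rowFirst leftPart rightPart
  rw [h.corner (0, 0, l, 0) (by simp [IsCornerComponent]),
    h.corner (r, 0, 0, 0) (by simp [IsCornerComponent])]
  simp

/-- A left corner lives on `g = (c, 0)` and a right corner on `g = (0, c)`. The supports could meet
only at `(0, 0)`, where corners vanish. -/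
theorem leftCorner_mul_rightCorner (h : IsA3Decomposition 1 η A P Q) (P' : Four ℕ ℕ → ℝ)
    (x y : HalfLegs) (g : ℕ × ℕ) : leftCorner P x g * rightCorner P' y g = 0 := by
  by_cases hg : g.2 = 0 ∧ g.1 = 0
  · rw [show g = (0, 0) from Prod.ext hg.2 hg.1, leftCorner_zero h, zero_mul]
  · by_cases hg2 : g.2 = 0
    · rw [rightCorner, if_neg (by tauto), mul_zero]
    · rw [leftCorner, if_neg (by tauto), zero_mul]

/-! ### The dangerous diagrams as contractions of corners. -/

/-- With a nonzero vertical index, a corner component vanishes when its horizontal index is `0`, so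
the restriction to `i, j ≠ 0` is automatic. -/
theorem dangerLeft_eq (h : IsA3Decomposition 1 η A P Q) (i j : ℕ) :
    dangerLeft P (i, j) = ∑' c : ℕ, P (0, 0, i, c + 1) * P (0, c + 1, j, 0) := by
  simp only [dangerLeft]
  split_ifs with hij
  · rfl
  · symm
    refine (tsum_congr fun c => ?_).trans tsum_zero
    by_cases hi : i = 0
    · rw [h.corner (0, 0, i, c + 1) (by simp [IsCornerComponent, hi]), zero_mul]
    · rw [h.corner (0, c + 1, j, 0) (by simp [IsCornerComponent]; tauto), mul_zero]

theorem dangerRight_eq (h : IsA3Decomposition 1 η A P Q) (i j : ℕ) :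
    dangerRight P (i, j) = ∑' c : ℕ, P (i, 0, 0, c + 1) * P (j, c + 1, 0, 0) := by
  simp only [dangerRight]
  split_ifs with hij
  · rfl
  · symm
    refine (tsum_congr fun c => ?_).trans tsum_zero
    by_cases hi : i = 0
    · rw [h.corner (i, 0, 0, c + 1) (by simp [IsCornerComponent, hi]), zero_mul]
    · rw [h.corner (j, c + 1, 0, 0) (by simp [IsCornerComponent]; tauto), mul_zero]

theorem tsum_leftCorner (h : IsA3Decomposition 1 η A P Q) (x y : HalfLegs) :
    ∑' g, leftCorner P x g * leftCorner (flipVert P) y g =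
      if x.1 = 0 ∧ x.2.1 = (0, 0) ∧ y.1 = 0 ∧ y.2.1 = (0, 0) then dangerLeft P (x.2.2, y.2.2)
      else 0 := by
  split_ifs with hc
  · obtain ⟨h1, h2, h3, h4⟩ := hc
    rw [dangerLeft_eq h]
    have inj : Function.Injective fun c : ℕ => (c + 1, 0) := fun c d hcd => by simpa using hcd
    rw [← inj.tsum_eq]
    · refine tsum_congr fun c => ?_
      simp [leftCorner, h1, h2, h3, h4, flipVert]
    · rintro ⟨g₁, g₂⟩ hg
      by_contra hn
      apply hg
      by_cases hg2 : g₂ = 0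
      · rcases g₁ with _ | c
        · simp [hg2, leftCorner_zero h]
        · exact (hn ⟨c, by simp [hg2]⟩).elim
      · simp [leftCorner, hg2]
  · refine (tsum_congr fun g => ?_).trans tsum_zero
    by_cases c : x.1 = 0 ∧ x.2.1 = (0, 0)
    · rw [leftCorner, leftCorner, if_neg (c := y.1 = 0 ∧ _) (by tauto), mul_zero]
    · rw [leftCorner, if_neg (by tauto), zero_mul]

theorem tsum_rightCorner (h : IsA3Decomposition 1 η A P Q) (x y : HalfLegs) :
    ∑' g, rightCorner P x g * rightCorner (flipVert P) y g =
      if x.2.2 = 0 ∧ x.2.1 = (0, 0) ∧ y.2.2 = 0 ∧ y.2.1 = (0, 0) then dangerRight P (x.1, y.1)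
      else 0 := by
  split_ifs with hc
  · obtain ⟨h1, h2, h3, h4⟩ := hc
    rw [dangerRight_eq h]
    have inj : Function.Injective fun c : ℕ => (0, c + 1) := fun c d hcd => by simpa using hcd
    rw [← inj.tsum_eq]
    · refine tsum_congr fun c => ?_
      simp [rightCorner, h1, h2, h3, h4, flipVert]
    · rintro ⟨g₁, g₂⟩ hg
      by_contra hn
      apply hg
      by_cases hg2 : g₁ = 0
      · rcases g₂ with _ | c
        · simp [hg2, rightCorner_zero h]
        · exact (hn ⟨c, by simp [hg2]⟩).elim
      · simp [rightCorner, hg2]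
  · refine (tsum_congr fun g => ?_).trans tsum_zero
    by_cases c : x.2.2 = 0 ∧ x.2.1 = (0, 0)
    · rw [rightCorner, rightCorner, if_neg (c := y.2.2 = 0 ∧ _) (by tauto), mul_zero]
    · rw [rightCorner, if_neg (by tauto), zero_mul]

/-- The sum over the vertical bond is itself a factorization between the upper leg `i` and the lower
leg `j`, with two factors of first order. -/
theorem nuclearLE_dangerLeft (h : IsA3Decomposition 1 η A P Q) (h0 : 0 < η) :
    NuclearLE (fun i j => dangerLeft P (i, j)) (η ^ 2) := by
  have := nuclearLE_contract (u := fun i c => P (0, 0, i, c + 1))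
    (v := fun j c => P (0, c + 1, j, 0)) h0 h0
    ((h.one_circle.comp (g := fun p : ℕ × ℕ => (0, 0, p.1, p.2 + 1))
      (by rintro ⟨_, _⟩ ⟨_, _⟩ h; simp_all)).mono (by linarith))
    ((h.one_circle.comp (g := fun p : ℕ × ℕ => (0, p.2 + 1, p.1, 0))
      (by rintro ⟨_, _⟩ ⟨_, _⟩ h; simp_all)).mono (by linarith))
  rw [← pow_two] at this
  exact this.congr fun i j => dangerLeft_eq h i j

theorem nuclearLE_dangerRight (h : IsA3Decomposition 1 η A P Q) (h0 : 0 < η) :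
    NuclearLE (fun i j => dangerRight P (i, j)) (η ^ 2) := by
  have := nuclearLE_contract (u := fun i c => P (i, 0, 0, c + 1))
    (v := fun j c => P (j, c + 1, 0, 0)) h0 h0
    ((h.one_circle.comp (g := fun p : ℕ × ℕ => (p.1, 0, 0, p.2 + 1))
      (by rintro ⟨_, _⟩ ⟨_, _⟩ h; simp_all)).mono (by linarith))
    ((h.one_circle.comp (g := fun p : ℕ × ℕ => (p.1, p.2 + 1, 0, 0))
      (by rintro ⟨_, _⟩ ⟨_, _⟩ h; simp_all)).mono (by linarith))
  rw [← pow_two] at this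
  exact this.congr fun i j => dangerRight_eq h i j

/-- The block, as a table with separated upper and lower legs. -/
noncomputable def blockHalves (A : Four ℕ ℕ → ℝ) (x y : HalfLegs) : ℝ :=
  blockTensor A ((x.1, y.1), x.2.1, (x.2.2, y.2.2), y.2.1)

/-- The two dangerous diagrams, as a table with separated upper and lower legs. -/
noncomputable def dangerHalves (P : Four ℕ ℕ → ℝ) (x y : HalfLegs) : ℝ :=
  (if x.1 = 0 ∧ x.2.1 = (0, 0) ∧ y.1 = 0 ∧ y.2.1 = (0, 0) then dangerLeft P (x.2.2, y.2.2)
    else 0) +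
  if x.2.2 = 0 ∧ x.2.1 = (0, 0) ∧ y.2.2 = 0 ∧ y.2.1 = (0, 0) then dangerRight P (x.1, y.1) else 0

theorem nuclearLE_blockHalves (h : IsA3Decomposition 1 η A P Q) (h0 : 0 < η) (h1 : η ≤ 1) :
    NuclearLE (blockHalves A) 81 := by
  refine ((nuclearLE_contract (u := rowTensor A A) (v := rowTensor (flipVert A) (flipVert A))
    (by norm_num) (by norm_num) (normLE_row h h0 h1)
    (normLE_row h.flipVert h0 h1)).mono (by norm_num : (9 : ℝ) * 9 ≤ 81)).congr fun x y => ?_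
  exact blockTensor_eq (h.normLE h0 h1) x y

/-- The block differs from the one of the fixed point by a table of first order. -/
theorem nuclearLE_blockHalves_sub (h : IsA3Decomposition 1 η A P Q) (h0 : 0 < η) (h1 : η ≤ 1) :
    NuclearLE (fun x y => blockHalves A x y -
      if x = (0, (0, 0), 0) ∧ y = (0, (0, 0), 0) then 1 else 0) (80 * η) := by
  have hu := normLE_row_sub h h0 h1
  have hv := normLE_row_sub h.flipVert h0 h1
  have hr := normLE_row h.flipVert h0 h1
  -- With `d` the row of the fixed point, `uv - dd = (u - d)v + d(v - d)`; the constant is `8 * 9 +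
  -- 1 * 8 = 80`.
  have n1 := nuclearLE_contract (u := fun x g => rowTensor A A x g - rowDelta x g)
    (v := rowTensor (flipVert A) (flipVert A)) (by positivity) (by norm_num) hu hr
  have n2 := nuclearLE_contract (u := rowDelta)
    (v := fun x g => rowTensor (flipVert A) (flipVert A) x g - rowDelta x g)
    one_pos (by positivity) normLE_rowDelta hv
  refine ((n1.add n2).mono (by linarith)).congr fun x y => ?_
  have s1 := NormLE.summable_contract (E := fun x g => rowTensor A A x g - rowDelta x g)
    (F := rowTensor (flipVert A) (flipVert A)) hu hr x y
  have s2 := NormLE.summable_contract (E := rowDelta)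
    (F := fun x g => rowTensor (flipVert A) (flipVert A) x g - rowDelta x g) normLE_rowDelta hv x y
  have s3 : HasSum (fun g => rowDelta x g * rowDelta y g)
      (if x = (0, (0, 0), 0) ∧ y = (0, (0, 0), 0) then 1 else 0) := by
    convert hasSum_single (0, 0) (f := fun g => rowDelta x g * rowDelta y g) fun g hg => ?_ using 1
    · by_cases hx : x = (0, (0, 0), 0) <;> by_cases hy : y = (0, (0, 0), 0) <;>
        simp [rowDelta, hx, hy]
    · simp [rowDelta, hg]
  rw [blockHalves, blockTensor_eq (h.normLE h0 h1), sub_eq_iff_eq_add, ← s1.tsum_add s2,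
    ← s3.tsum_eq, ← (s1.add s2).tsum_add s3.summable]
  refine tsum_congr fun g => ?_
  ring

/-- Up to a nuclear remainder of third order, the block is the sum of a product table and of the
two dangerous diagrams. -/
theorem nuclearLE_blockHalves_remainder (h : IsA3Decomposition 1 η A P Q) (h0 : 0 < η)
    (h1 : η ≤ 1) :
    NuclearLE (fun x y => blockHalves A x y -
      rowTensor A A x (0, 0) * rowTensor (flipVert A) (flipVert A) y (0, 0) -
      dangerHalves P x y) (60 * η ^ 3) := by
  have h' := h.flipVert
  have second : ∀ {A P Q : Four ℕ ℕ → ℝ}, IsA3Decomposition 1 η A P Q →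
      NormLE (fun p : HalfLegs × ℕ × ℕ => if p.2 = (0, 0) then 0 else rowSecond P Q p.1 p.2)
        (6 * η ^ 2) := by
    intro A P Q h
    refine (normLE_rowSecond h h0 h1).of_abs_le fun p => ?_
    split_ifs <;> simp
  have hu1 := normLE_corners h
  have hu2 := second h
  have hv2 := second h'
  have hv12 := (normLE_corners h').add hv2
  set u1 : HalfLegs → ℕ × ℕ → ℝ := fun x g => leftCorner P x g + rightCorner P x g
  set u2 : HalfLegs → ℕ × ℕ → ℝ := fun x g => if g = (0, 0) then 0 else rowSecond P Q x g
  set v1 : HalfLegs → ℕ × ℕ → ℝ := fun x g =>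
    leftCorner (flipVert P) x g + rightCorner (flipVert P) x g
  set v2 : HalfLegs → ℕ × ℕ → ℝ := fun x g =>
    if g = (0, 0) then 0 else rowSecond (flipVert P) (flipVert Q) x g
  -- For `g ≠ (0, 0)` the rows are `u1 + u2` and `v1 + v2`, and `(u1 + u2)(v1 + v2) - u1 v1 = u1 v2
  -- + u2 (v1 + v2)`. The constants are `2 * 6` and `6 * (2 + 6)`, in all `60`.
  have n1 := nuclearLE_contract (u := u1) (v := v2) (by positivity) (by positivity) hu1 hv2
  have n2 := nuclearLE_contract (u := u2) (v := fun x g => v1 x g + v2 x g) (by positivity)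
    (by positivity) hu2 hv12
  refine ((n1.add n2).mono ?_).congr fun x y => ?_
  · nlinarith [pow_pos h0 3]
  have s1 := NormLE.summable_contract (E := u1) (F := v2) hu1 hv2 x y
  have s2 := NormLE.summable_contract (E := u2) (F := fun x g => v1 x g + v2 x g) hu2 hv12 x y
  have s3 := NormLE.summable_contract (E := leftCorner P) (F := leftCorner (flipVert P))
    (normLE_leftCorner h.one_circle) (normLE_leftCorner h'.one_circle) x y
  have s4 := NormLE.summable_contract (E := rightCorner P) (F := rightCorner (flipVert P))
    (normLE_rightCorner h.one_circle) (normLE_rightCorner h'.one_circle) x y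
  have s5 := hasSum_ite_eq ((0, 0) : ℕ × ℕ)
    (rowTensor A A x (0, 0) * rowTensor (flipVert A) (flipVert A) y (0, 0))
  rw [blockHalves, blockTensor_eq (h.normLE h0 h1), dangerHalves, ← tsum_leftCorner h,
    ← tsum_rightCorner h, sub_eq_iff_eq_add, sub_eq_iff_eq_add, ← s1.tsum_add s2, ← s5.tsum_eq,
    ← s3.tsum_add s4, ← (s1.add s2).tsum_add (s3.add s4),
    ← ((s1.add s2).add (s3.add s4)).tsum_add s5.summable]
  refine tsum_congr fun g => ?_
  have z1 := leftCorner_mul_rightCorner h (flipVert P) x y g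
  have z2 := leftCorner_mul_rightCorner h' P y x g
  by_cases hg : g = (0, 0)
  · subst hg
    simp [u1, u2, v1, v2, leftCorner_zero h, rightCorner_zero h]
  · have d0 : ∀ x, rowDelta x g = 0 := fun x => by simp [rowDelta, hg]
    rw [rowTensor_eq h h0 h1, rowTensor_eq h' h0 h1, d0, d0, rowFirst_of_ne h x hg,
      rowFirst_of_ne h' y hg]
    simp only [u1, u2, v1, v2, hg, if_false]
    linear_combination z1 + z2


/-! ### The disentangler -/

section Exponential

/-- The coefficients of `b` and `b ^ 2` in `b ^ (n + 1)`, when `b ^ 3 = -ρ b`. -/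
def powerCoeffs (ρ : ℝ) : ℕ → ℝ × ℝ
  | 0 => (1, 0)
  | n + 1 => (-ρ * (powerCoeffs ρ n).2, (powerCoeffs ρ n).1)

theorem pow_succ_eq_powerCoeffs {𝔸 : Type*} [Ring 𝔸] [Algebra ℝ 𝔸] {ρ : ℝ} {b : 𝔸}
    (hb : b * b * b = -(ρ • b)) (n : ℕ) :
    b ^ (n + 1) = (powerCoeffs ρ n).1 • b + (powerCoeffs ρ n).2 • (b * b) := by
  induction n with
  | zero => simp [powerCoeffs]
  | succ n ih =>
    rw [pow_succ, ih, add_mul, smul_mul_assoc, smul_mul_assoc, hb, powerCoeffs]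
    rw [add_comm, smul_neg, smul_smul, neg_mul, neg_smul, mul_comm]

theorem abs_powerCoeffs_le {ρ : ℝ} (hρ : |ρ| ≤ 1) (n : ℕ) :
    |(powerCoeffs ρ n).1| ≤ 1 ∧ |(powerCoeffs ρ n).2| ≤ 1 := by
  induction n with
  | zero => simp [powerCoeffs]
  | succ n ih =>
    refine ⟨?_, ih.1⟩
    rw [powerCoeffs, abs_mul, abs_neg]
    exact mul_le_one₀ hρ (abs_nonneg _) ih.2

theorem inv_factorial_succ_le (n : ℕ) : (((n + 1).factorial : ℝ))⁻¹ ≤ (1 / 2) ^ n := by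
  rw [one_div, inv_pow]
  refine inv_anti₀ (by positivity) ?_
  induction n with
  | zero => simp
  | succ n ih =>
    rw [Nat.factorial_succ, pow_succ, mul_comm]
    push_cast at ih ⊢
    exact mul_le_mul (by linarith [(Nat.cast_nonneg n : (0 : ℝ) ≤ n)]) ih (by positivity)
      (by positivity)

/-- The exponential of an element with `b ^ 3 = -ρ b` is a quadratic polynomial. -/
theorem exists_exp_eq {ρ : ℝ} (hρ : |ρ| ≤ 1) :
    ∃ s k : ℝ, |s - 1| ≤ |ρ| ∧ |k| ≤ 2 ∧
      ∀ {𝔸 : Type} [NormedRing 𝔸] [NormedAlgebra ℝ 𝔸] [CompleteSpace 𝔸] (b : 𝔸),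
        b * b * b = -(ρ • b) → NormedSpace.exp b = 1 + s • b + k • (b * b) := by
  have geo := hasSum_geometric_two
  have hx : ∀ n : ℕ, ‖((n + 1).factorial : ℝ)⁻¹ * (powerCoeffs ρ n).1‖ ≤ (1 / 2) ^ n := by
    intro n
    rw [Real.norm_eq_abs, abs_mul, abs_of_pos (by positivity), ← mul_one ((1 / 2 : ℝ) ^ n)]
    exact mul_le_mul (inv_factorial_succ_le n) (abs_powerCoeffs_le hρ n).1 (abs_nonneg _)
      (by positivity)
  have hy : ∀ n : ℕ, ‖((n + 1).factorial : ℝ)⁻¹ * (powerCoeffs ρ n).2‖ ≤ (1 / 2) ^ n := by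
    intro n
    rw [Real.norm_eq_abs, abs_mul, abs_of_pos (by positivity), ← mul_one ((1 / 2 : ℝ) ^ n)]
    exact mul_le_mul (inv_factorial_succ_le n) (abs_powerCoeffs_le hρ n).2 (abs_nonneg _)
      (by positivity)
  have sx : Summable fun n : ℕ => ((n + 1).factorial : ℝ)⁻¹ * (powerCoeffs ρ n).1 :=
    Summable.of_norm_bounded geo.summable hx
  have sy : Summable fun n : ℕ => ((n + 1).factorial : ℝ)⁻¹ * (powerCoeffs ρ n).2 :=
    Summable.of_norm_bounded geo.summable hy
  refine ⟨∑' n : ℕ, ((n + 1).factorial : ℝ)⁻¹ * (powerCoeffs ρ n).1,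
    ∑' n : ℕ, ((n + 1).factorial : ℝ)⁻¹ * (powerCoeffs ρ n).2, ?_,
    tsum_of_norm_bounded geo hy, ?_⟩
  -- The term `n = 0` is `1`. Every later coefficient of `b` carries a factor `ρ`, and the inverse
  -- factorials from `2!` on are dominated by a geometric series of sum `1`.
  · rw [sx.tsum_eq_zero_add]
    have h1 : ∀ n : ℕ, ‖((n + 1 + 1).factorial : ℝ)⁻¹ * (powerCoeffs ρ (n + 1)).1‖ ≤
        |ρ| * (1 / 2) * (1 / 2) ^ n := by
      intro n
      have h2 := inv_factorial_succ_le (n + 1)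
      rw [pow_succ] at h2
      rw [Real.norm_eq_abs, abs_mul, abs_of_pos (by positivity), powerCoeffs, abs_mul, abs_neg]
      have h3 := (abs_powerCoeffs_le hρ n).2
      calc _ ≤ (1 / 2) ^ n * (1 / 2) * (|ρ| * 1) :=
            mul_le_mul h2 (mul_le_mul_of_nonneg_left h3 (abs_nonneg _)) (by positivity)
              (by positivity)
        _ = _ := by ring
    have h4 := tsum_of_norm_bounded (geo.mul_left (|ρ| * (1 / 2))) h1
    rw [Real.norm_eq_abs] at h4
    have h5 : ((0 + 1).factorial : ℝ)⁻¹ * (powerCoeffs ρ 0).1 = 1 := by simp [powerCoeffs]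
    rw [h5, add_sub_cancel_left]
    linarith
  · intro 𝔸 _ _ _ b hb
    have e1 := NormedSpace.exp_series_hasSum_exp' (𝕂 := ℝ) b
    have e2 := (sx.hasSum.smul_const b).add (sy.hasSum.smul_const (b * b))
    have e3 : HasSum (fun n : ℕ => ((n + 1).factorial : ℝ)⁻¹ • b ^ (n + 1))
        ((∑' n : ℕ, ((n + 1).factorial : ℝ)⁻¹ * (powerCoeffs ρ n).1) • b +
          (∑' n : ℕ, ((n + 1).factorial : ℝ)⁻¹ * (powerCoeffs ρ n).2) • (b * b)) := by
      convert e2 using 2 with n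
      rw [pow_succ_eq_powerCoeffs hb, smul_add, smul_smul, smul_smul]
    have e4 := (hasSum_nat_add_iff (f := fun n : ℕ => (n.factorial : ℝ)⁻¹ • b ^ n) 1).1 e3
    rw [e1.unique e4]
    simp only [Finset.range_one, Finset.sum_singleton, Nat.factorial_zero, Nat.cast_one, inv_one,
      pow_zero, one_smul]
    abel

end Exponential

section Operators

open InnerProductSpace

variable {ι : Type} [DecidableEq ι]

theorem basisVec_apply (i j : ι) : basisVec i j = if j = i then (1 : ℝ) else 0 := by
  simp [basisVec, Pi.single_apply]

theorem inner_basisVec (f : L2 ι) (i : ι) : inner ℝ f (basisVec i) = f i := by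
  simp [basisVec, lp.inner_single_right]

theorem norm_basisVec (i : ι) : ‖basisVec i‖ = 1 := by
  simp [basisVec, lp.norm_single]

theorem matElem_rankOne (f g : L2 ι) (p q : ι) : matElem (rankOne ℝ f g) p q = f p * g q := by
  simp [matElem, rankOne_apply, inner_basisVec, mul_comm]

/-- The matrix elements of `σ (|l⟩⟨00| - |00⟩⟨r|) - k (|l⟩⟨r| + ρ |00⟩⟨00|)`. -/
def disentanglerKernel (l r : ℕ × ℕ → ℝ) (σ k ρ : ℝ) (p q : ℕ × ℕ) : ℝ :=
  σ * (l p * if q = (0, 0) then 1 else 0) + -σ * ((if p = (0, 0) then 1 else 0) * r q) +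
    -k * (l p * r q) +
    -(k * ρ) * ((if p = (0, 0) then 1 else 0) * if q = (0, 0) then 1 else 0)

/-- The disentangler of two given vectors without component along `00`, and its inverse. -/
theorem exists_disentangler {l r : L2 (ℕ × ℕ)} {c : ℝ} (hc1 : c ≤ 1) (hl : ‖l‖ ≤ c)
    (hr : ‖r‖ ≤ c) (hl0 : l (0, 0) = 0) (hr0 : r (0, 0) = 0) :
    ∃ (B : L2 (ℕ × ℕ) →L[ℝ] L2 (ℕ × ℕ)) (R : L2 (ℕ × ℕ) ≃L[ℝ] L2 (ℕ × ℕ)) (s k ρ : ℝ),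
      ‖B‖ ≤ 2 * c ∧
      (∀ p q, matElem B p q =
        (if q = (0, 0) then l p else 0) - (if p = (0, 0) then r q else 0)) ∧
      (R : L2 (ℕ × ℕ) →L[ℝ] L2 (ℕ × ℕ)) = NormedSpace.exp B ∧
      |ρ| ≤ c ^ 2 ∧ |s - 1| ≤ |ρ| ∧ |k| ≤ 2 ∧
      (∀ p q, matElem (R : L2 (ℕ × ℕ) →L[ℝ] L2 (ℕ × ℕ)) p q =
        (if p = q then 1 else 0) + disentanglerKernel l r s k ρ p q) ∧
      ∀ p q, matElem (R.symm : L2 (ℕ × ℕ) →L[ℝ] L2 (ℕ × ℕ)) p q =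
        (if p = q then 1 else 0) + disentanglerKernel l r (-s) k ρ p q := by
  have hc0 : 0 ≤ c := (norm_nonneg _).trans hl
  set e : L2 (ℕ × ℕ) := basisVec (0, 0) with he
  set ρ : ℝ := inner ℝ r l with hρdef
  have hρ : |ρ| ≤ c ^ 2 := by
    refine (abs_real_inner_le_norm r l).trans ?_
    rw [pow_two]
    exact mul_le_mul hr hl (norm_nonneg _) hc0
  have hρ1 : |ρ| ≤ 1 := hρ.trans (pow_le_one₀ hc0 hc1)
  -- Since `s` and `k` depend on `ρ` alone, they serve both `B` and `-B`; so the inverse `exp (-B)`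
  -- differs from `exp B` only in the sign of `s`.
  obtain ⟨s, k, hs, hk, hexp⟩ := exists_exp_eq hρ1
  set B : L2 (ℕ × ℕ) →L[ℝ] L2 (ℕ × ℕ) := rankOne ℝ l e - rankOne ℝ e r with hB
  have hel : inner ℝ e l = 0 := by rw [real_inner_comm, he, inner_basisVec, hl0]
  have hre : inner ℝ r e = 0 := by rw [he, inner_basisVec, hr0]
  have hee : inner ℝ e e = (1 : ℝ) := by rw [he, inner_basisVec, basisVec_apply, if_pos rfl]
  have hBB : B * B = -rankOne ℝ l r - ρ • rankOne ℝ e e := by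
    ext1 z
    simp only [hB, mul_apply_eq_comp, sub_apply, rankOne_apply,
      inner_sub_right, inner_smul_right, hel, hre, hee, neg_apply,
      smul_apply]
    rw [← hρdef]
    module
  have hBBB : B * B * B = -(ρ • B) := by
    rw [hBB]
    ext1 z
    simp only [hB, mul_apply_eq_comp, sub_apply, rankOne_apply,
      inner_sub_right, inner_smul_right, hel, hre, hee, neg_apply,
      smul_apply]
    rw [← hρdef]
    module
  have hcomm : ∀ D : L2 (ℕ × ℕ) →L[ℝ] L2 (ℕ × ℕ),
      NormedSpace.exp D * NormedSpace.exp (-D) = 1 := by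
    intro D
    let _ : NormedAlgebra ℚ (L2 (ℕ × ℕ) →L[ℝ] L2 (ℕ × ℕ)) := .restrictScalars ℚ ℝ _
    have := NormedSpace.exp_add_of_commute (Commute.neg_right (Commute.refl D))
    rw [← this, add_neg_cancel, NormedSpace.exp_zero]
  have h1 : NormedSpace.exp B * NormedSpace.exp (-B) = 1 := hcomm B
  have h2 : NormedSpace.exp (-B) * NormedSpace.exp B = 1 := by
    have := hcomm (-B)
    rwa [neg_neg] at this
  have hneg : (-B) * (-B) * (-B) = -(ρ • (-B)) := by
    rw [neg_mul_neg, mul_neg, hBBB, smul_neg]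
  refine ⟨B, ContinuousLinearEquiv.equivOfInverse (NormedSpace.exp B) (NormedSpace.exp (-B))
    (fun z => by simpa using congrArg (fun D => D z) h2)
    (fun z => by simpa using congrArg (fun D => D z) h1), s, k, ρ, ?_, ?_, ?_, hρ, hs, hk, ?_, ?_⟩
  · refine (norm_sub_le _ _).trans ?_
    rw [norm_rankOne, norm_rankOne, he, norm_basisVec]
    linarith
  · intro p q
    have : matElem B p q = matElem (rankOne ℝ l e) p q - matElem (rankOne ℝ e r) p q := rfl
    rw [this, matElem_rankOne, matElem_rankOne, he, basisVec_apply, basisVec_apply]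
    split_ifs <;> simp
  · ext1 z
    rfl
  · intro p q
    have h3 : matElem (NormedSpace.exp B) p q = basisVec q p + s * matElem B p q +
        k * matElem (B * B) p q := by
      rw [hexp B hBBB]
      rfl
    have h4 : matElem (B * B) p q =
        -matElem (rankOne ℝ l r) p q - ρ * matElem (rankOne ℝ e e) p q := by
      rw [hBB]
      rfl
    have h5 : matElem B p q = matElem (rankOne ℝ l e) p q - matElem (rankOne ℝ e r) p q := rfl
    change matElem (NormedSpace.exp B) p q = _
    rw [h3, h4, h5]
    simp only [matElem_rankOne, he, basisVec_apply, disentanglerKernel]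
    ring
  · intro p q
    have h3 : matElem (NormedSpace.exp (-B)) p q = basisVec q p + s * -matElem B p q +
        k * matElem (B * B) p q := by
      rw [hexp (-B) hneg, neg_mul_neg]
      rfl
    have h4 : matElem (B * B) p q =
        -matElem (rankOne ℝ l r) p q - ρ * matElem (rankOne ℝ e e) p q := by
      rw [hBB]
      rfl
    have h5 : matElem B p q = matElem (rankOne ℝ l e) p q - matElem (rankOne ℝ e r) p q := rfl
    change matElem (NormedSpace.exp (-B)) p q = _
    rw [h3, h4, h5]
    simp only [matElem_rankOne, he, basisVec_apply, disentanglerKernel]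
    ring

end Operators

/-! ### Trace norm of the disentangler across the horizontal cut. -/

section Kernel

variable {l r : ℕ × ℕ → ℝ} {σ k ρ : ℝ}

theorem nuclearLE_delta {X Y : Type} [DecidableEq X] [DecidableEq Y] (x₀ : X) (y₀ : Y) :
    NuclearLE (fun x y => if x = x₀ ∧ y = y₀ then (1 : ℝ) else 0) 1 := by
  have := nuclearLE_mul one_pos one_pos
    (normLE_indicator (fun x => x = x₀) fun _ _ h h' => h.trans h'.symm)
    (normLE_indicator (fun y => y = y₀) fun _ _ h h' => h.trans h'.symm)
  rw [one_mul] at this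
  refine this.congr fun x y => ?_
  by_cases hx : x = x₀ <;> by_cases hy : y = y₀ <;> simp [hx, hy]

theorem nuclearLE_delta_zero :
    NuclearLE (fun i j : ℕ => if (i, j) = (0, 0) then (1 : ℝ) else 0) 1 :=
  (nuclearLE_delta 0 0).congr fun i j => by simp only [Prod.mk.injEq]

/-- The cut separates the upper indices of `p` and `q` from the lower ones, so each term of the
kernel is a tensor product of tables nuclear across the cut: `l`, `r` or the delta at `00`. Each of
the four terms is at most `2 * η ^ 2`. -/
theorem nuclearLE_kernel (h0 : 0 < η) (h1 : η ≤ 1) (hl : NuclearLE (fun i j => l (i, j)) (η ^ 2))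
    (hr : NuclearLE (fun i j => r (i, j)) (η ^ 2)) (hσ : |σ| ≤ 2) (hk : |k| ≤ 2)
    (hρ : |ρ| ≤ η ^ 4) :
    NuclearLE (fun x y : ℕ × ℕ => disentanglerKernel l r σ k ρ (x.1, y.1) (x.2, y.2))
      (8 * η ^ 2) := by
  have prod : ∀ {f g : ℕ × ℕ → ℝ} {a b : ℝ}, NuclearLE (fun i j => f (i, j)) a →
      NuclearLE (fun i j => g (i, j)) b →
      NuclearLE (fun x y : ℕ × ℕ => f (x.1, y.1) * g (x.2, y.2)) (a * b) := by
    intro f g a b hf hg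
    rw [mul_comm]
    exact (hg.mul hf).congr fun x y => mul_comm _ _
  have hd : NuclearLE (fun i j : ℕ => (fun p : ℕ × ℕ => if p = (0, 0) then (1 : ℝ) else 0) (i, j))
      1 := nuclearLE_delta_zero
  have hkρ : |(-(k * ρ))| ≤ 2 * η ^ 4 := by
    rw [abs_neg, abs_mul]
    exact mul_le_mul hk hρ (abs_nonneg _) (by norm_num)
  have t1 := (prod (f := l) (g := fun q => if q = (0, 0) then 1 else 0) hl hd).const_mul hσ
    two_pos
  have t2 := (prod (f := fun p => if p = (0, 0) then 1 else 0) (g := r) hd hr).const_mul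
    ((abs_neg σ).le.trans hσ) two_pos
  have t3 := (prod (f := l) (g := r) hl hr).const_mul ((abs_neg k).le.trans hk) two_pos
  have t4 := (prod (f := fun p => if p = (0, 0) then 1 else 0)
    (g := fun q => if q = (0, 0) then 1 else 0) hd hd).const_mul hkρ (by positivity)
  refine (((t1.add t2).add t3).add t4).mono ?_
  have : η ^ 4 ≤ η ^ 2 := pow_le_pow_of_le_one h0.le h1 (by norm_num)
  nlinarith

end Kernel

/-- A bilinear form evaluated at perturbations of two basis vectors. -/
theorem tsum_perturbed_basis {ι : Type} [DecidableEq ι] {f g : ι → ℝ} {T : ι × ι → ℝ}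
    (hf : Summable fun a => f a ^ 2) (hg : Summable fun a => g a ^ 2)
    (hT : Summable fun z => T z ^ 2) (i j : ι) :
    ∑' z : ι × ι, ((if i = z.1 then 1 else 0) + f z.1) * T z *
        ((if z.2 = j then 1 else 0) + g z.2) =
      T (i, j) + ∑' a, f a * T (a, j) + ∑' b, g b * T (i, b) +
        ∑' z : ι × ι, f z.1 * g z.2 * T z := by
  have i1 : Function.Injective fun a : ι => (a, j) := fun _ _ h => (Prod.mk.inj h).1
  have i2 : Function.Injective fun b : ι => (i, b) := fun _ _ h => (Prod.mk.inj h).2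
  have c1 : Summable fun a => T (a, j) ^ 2 := hT.comp_injective i1
  have c2 : Summable fun b => T (i, b) ^ 2 := hT.comp_injective i2
  have fg : Summable fun z : ι × ι => (f z.1 * g z.2) ^ 2 :=
    (NormLE.mul (c := hsNorm f) (d := hsNorm g) ⟨hf, le_rfl⟩ ⟨hg, le_rfl⟩).1
  have s1 : HasSum (fun z : ι × ι => (if i = z.1 then 1 else 0) * T z * (if z.2 = j then 1 else 0))
      (T (i, j)) := by
    convert hasSum_single (i, j) (f := fun z : ι × ι =>
      (if i = z.1 then 1 else 0) * T z * (if z.2 = j then 1 else 0)) fun z hz => ?_ using 1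
    · simp
    · by_cases h1 : i = z.1
      · have h2 : z.2 ≠ j := fun h2 => hz (Prod.ext h1.symm h2)
        simp [h2]
      · simp [h1]
  have s2 : HasSum (fun z : ι × ι => f z.1 * T z * (if z.2 = j then 1 else 0))
      (∑' a, f a * T (a, j)) := by
    refine (i1.hasSum_iff ?_).1 ?_
    · rintro ⟨a, b⟩ hz
      have : b ≠ j := fun h => hz ⟨a, by simp [h]⟩
      simp [this]
    · simpa [Function.comp_def] using (summable_mul_of_sq hf c1).hasSum
  have s3 : HasSum (fun z : ι × ι => (if i = z.1 then 1 else 0) * T z * g z.2)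
      (∑' b, g b * T (i, b)) := by
    refine (i2.hasSum_iff ?_).1 ?_
    · rintro ⟨a, b⟩ hz
      have : i ≠ a := fun h => hz ⟨b, by simp [h]⟩
      simp [this]
    · simpa [Function.comp_def, mul_comm] using (summable_mul_of_sq hg c2).hasSum
  have s4 := (summable_mul_of_sq fg hT).hasSum
  rw [← (((s1.add s2).add s3).add s4).tsum_eq]
  refine tsum_congr fun z => ?_
  ring

/-- The left action of a nuclear kernel on a nuclear table. -/
theorem NuclearLE.act_left {m : ℕ × ℕ → ℕ × ℕ → ℝ} {F : HalfLegs → HalfLegs → ℝ} {a b : ℝ}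
    (hm : NuclearLE (fun x y : ℕ × ℕ => m (x.1, y.1) (x.2, y.2)) a) (hF : NuclearLE F b) :
    NuclearLE (fun x y : HalfLegs => ∑' z : ℕ × ℕ,
      m (x.2.2, y.2.2) z * F (x.1, x.2.1, z.1) (y.1, y.2.1, z.2))
      (a * b) := by
  have hF' : NuclearLE (fun x y : (ℕ × (ℕ × ℕ)) × ℕ => F (x.1.1, x.1.2, x.2) (y.1.1, y.1.2, y.2))
      b := hF.comp (f := fun x : (ℕ × (ℕ × ℕ)) × ℕ => (x.1.1, x.1.2, x.2))
    (g := fun x : (ℕ × (ℕ × ℕ)) × ℕ => (x.1.1, x.1.2, x.2))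
    (by rintro ⟨⟨_, _⟩, _⟩ ⟨⟨_, _⟩, _⟩ h; simp_all) (by rintro ⟨⟨_, _⟩, _⟩ ⟨⟨_, _⟩, _⟩ h; simp_all)
  exact (hm.contract hF').comp (f := fun x : HalfLegs => ((x.1, x.2.1), x.2.2))
    (g := fun x : HalfLegs => ((x.1, x.2.1), x.2.2))
    (by rintro ⟨_, _, _⟩ ⟨_, _, _⟩ h; simp_all) (by rintro ⟨_, _, _⟩ ⟨_, _, _⟩ h; simp_all)

/-- The right action of a nuclear kernel on a nuclear table. -/
theorem NuclearLE.act_right {m : ℕ × ℕ → ℕ × ℕ → ℝ} {F : HalfLegs → HalfLegs → ℝ} {a b : ℝ}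
    (hm : NuclearLE (fun x y : ℕ × ℕ => m (x.1, y.1) (x.2, y.2)) a) (hF : NuclearLE F b) :
    NuclearLE (fun x y : HalfLegs => ∑' z : ℕ × ℕ,
      m z (x.1, y.1) * F (z.1, x.2.1, x.2.2) (z.2, y.2.1, y.2.2))
      (a * b) := by
  have hm' : NuclearLE (fun x y : ℕ × ℕ => m (x.2, y.2) (x.1, y.1)) a :=
    hm.comp (f := Prod.swap) (g := Prod.swap) Prod.swap_injective Prod.swap_injective
  have hF' : NuclearLE (fun x y : ((ℕ × ℕ) × ℕ) × ℕ => F (x.2, x.1.1, x.1.2) (y.2, y.1.1, y.1.2))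
      b := hF.comp (f := fun x : ((ℕ × ℕ) × ℕ) × ℕ => (x.2, x.1.1, x.1.2))
    (g := fun x : ((ℕ × ℕ) × ℕ) × ℕ => (x.2, x.1.1, x.1.2))
    (by rintro ⟨⟨_, _⟩, _⟩ ⟨⟨_, _⟩, _⟩ h; simp_all) (by rintro ⟨⟨_, _⟩, _⟩ ⟨⟨_, _⟩, _⟩ h; simp_all)
  exact (hm'.contract hF').comp (f := fun x : HalfLegs => (x.2, x.1))
    (g := fun x : HalfLegs => (x.2, x.1)) Prod.swap_injective Prod.swap_injective

/-- The simultaneous action of nuclear kernels on both sides of a nuclear table. -/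
theorem NuclearLE.act_both {m m' : ℕ × ℕ → ℕ × ℕ → ℝ} {F : HalfLegs → HalfLegs → ℝ} {a a' b : ℝ}
    (hm : NuclearLE (fun x y : ℕ × ℕ => m (x.1, y.1) (x.2, y.2)) a)
    (hm' : NuclearLE (fun x y : ℕ × ℕ => m' (x.1, y.1) (x.2, y.2)) a') (hF : NuclearLE F b) :
    NuclearLE (fun x y : HalfLegs => ∑' z : (ℕ × ℕ) × (ℕ × ℕ),
      m (x.2.2, y.2.2) z.1 * m' z.2 (x.1, y.1) *
      F (z.2.1, x.2.1, z.1.1) (z.2.2, y.2.1, z.1.2)) (a * a' * b) := by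
  have hM : NuclearLE (fun x y : (ℕ × ℕ) × (ℕ × ℕ) =>
      m (x.1.1, y.1.1) (x.2.1, y.2.1) * m' (x.2.2, y.2.2) (x.1.2, y.1.2)) (a * a') :=
    (hm.mul hm').comp (f := fun x : (ℕ × ℕ) × (ℕ × ℕ) => ((x.2.2, x.1.2), (x.1.1, x.2.1)))
      (g := fun x : (ℕ × ℕ) × (ℕ × ℕ) => ((x.2.2, x.1.2), (x.1.1, x.2.1)))
      (by rintro ⟨⟨_, _⟩, _, _⟩ ⟨⟨_, _⟩, _, _⟩ h; simp_all)
      (by rintro ⟨⟨_, _⟩, _, _⟩ ⟨⟨_, _⟩, _, _⟩ h; simp_all)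
  have hF' : NuclearLE (fun x y : (ℕ × ℕ) × (ℕ × ℕ) => F (x.2.2, x.1, x.2.1) (y.2.2, y.1, y.2.1))
      b := hF.comp (f := fun x : (ℕ × ℕ) × (ℕ × ℕ) => (x.2.2, x.1, x.2.1))
    (g := fun x : (ℕ × ℕ) × (ℕ × ℕ) => (x.2.2, x.1, x.2.1))
    (by rintro ⟨_, _, _⟩ ⟨_, _, _⟩ h; simp_all) (by rintro ⟨_, _, _⟩ ⟨_, _, _⟩ h; simp_all)
  refine ((hM.contract hF').comp (f := fun x : HalfLegs => (x.2.1, (x.2.2, x.1)))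
    (g := fun x : HalfLegs => (x.2.1, (x.2.2, x.1)))
    (by rintro ⟨_, _, _⟩ ⟨_, _, _⟩ h; simp_all)
    (by rintro ⟨_, _, _⟩ ⟨_, _, _⟩ h; simp_all)).congr fun x y => ?_
  rw [← (Equiv.prodProdProdComm ℕ ℕ ℕ ℕ).tsum_eq]
  rfl

/-- A dangerous diagram with further legs in the state `0`. -/
theorem nuclearLE_dangerLeft_ite (h : IsA3Decomposition 1 η A P Q) (h0 : 0 < η) :
    NuclearLE (fun x y : HalfLegs => if x.1 = 0 ∧ x.2.1 = (0, 0) ∧ y.1 = 0 ∧ y.2.1 = (0, 0) then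
      dangerLeft P (x.2.2, y.2.2) else 0) (η ^ 2) := by
  have := (nuclearLE_dangerLeft h h0).mul (nuclearLE_delta ((0, (0, 0)) : ℕ × ℕ × ℕ)
    ((0, (0, 0)) : ℕ × ℕ × ℕ))
  rw [mul_one] at this
  refine (this.comp (f := fun x : HalfLegs => ((x.1, x.2.1), x.2.2))
    (g := fun x : HalfLegs => ((x.1, x.2.1), x.2.2))
    (by rintro ⟨_, _, _⟩ ⟨_, _, _⟩ h; simp_all)
    (by rintro ⟨_, _, _⟩ ⟨_, _, _⟩ h; simp_all)).congr fun x y => ?_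
  rw [mul_ite, mul_one, mul_zero]
  refine if_congr ?_ rfl rfl
  simp only [Prod.mk.injEq]
  tauto

theorem nuclearLE_dangerRight_ite (h : IsA3Decomposition 1 η A P Q) (h0 : 0 < η) :
    NuclearLE (fun x y : HalfLegs => if x.2.2 = 0 ∧ x.2.1 = (0, 0) ∧ y.2.2 = 0 ∧ y.2.1 = (0, 0) then
      dangerRight P (x.1, y.1) else 0) (η ^ 2) := by
  have := (nuclearLE_dangerRight h h0).mul (nuclearLE_delta ((0, (0, 0)) : ℕ × ℕ × ℕ)
    ((0, (0, 0)) : ℕ × ℕ × ℕ))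
  rw [mul_one] at this
  refine (this.comp (f := fun x : HalfLegs => ((x.2.2, x.2.1), x.1))
    (g := fun x : HalfLegs => ((x.2.2, x.2.1), x.1))
    (by rintro ⟨_, _, _⟩ ⟨_, _, _⟩ h; simp_all)
    (by rintro ⟨_, _, _⟩ ⟨_, _, _⟩ h; simp_all)).congr fun x y => ?_
  rw [mul_ite, mul_one, mul_zero]
  refine if_congr ?_ rfl rfl
  simp only [Prod.mk.injEq]
  tauto

/-- The disentangled block is a product table up to a nuclear remainder of third order. -/
theorem nuclearLE_disentangle (h : IsA3Decomposition 1 η A P Q) (h0 : 0 < η) (h1 : η ≤ 1)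
    {R : L2 (ℕ × ℕ) ≃L[ℝ] L2 (ℕ × ℕ)} {s k ρ : ℝ} (hρ : |ρ| ≤ η ^ 4) (hs : |s - 1| ≤ |ρ|)
    (hk : |k| ≤ 2)
    (hR : ∀ p q, matElem (R : L2 (ℕ × ℕ) →L[ℝ] L2 (ℕ × ℕ)) p q =
      (if p = q then 1 else 0) + disentanglerKernel (dangerLeft P) (dangerRight P) s k ρ p q)
    (hR' : ∀ p q, matElem (R.symm : L2 (ℕ × ℕ) →L[ℝ] L2 (ℕ × ℕ)) p q =
      (if p = q then 1 else 0) + disentanglerKernel (dangerLeft P) (dangerRight P) (-s) k ρ p q) :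
    NuclearLE (fun x y => disentangle R (blockTensor A)
      ((x.1, y.1), x.2.1, (x.2.2, y.2.2), y.2.1) -
      rowTensor A A x (0, 0) * rowTensor (flipVert A) (flipVert A) y (0, 0)) (10000 * η ^ 3) := by
  have hη4 : η ^ 4 ≤ 1 := pow_le_one₀ h0.le h1
  have hs2 : |s| ≤ 2 := by
    have := abs_sub_abs_le_abs_sub s 1
    rw [abs_one] at this
    linarith
  have hm := nuclearLE_kernel h0 h1 (nuclearLE_dangerLeft h h0) (nuclearLE_dangerRight h h0)
    (σ := -s) ((abs_neg s).le.trans hs2) hk hρ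
  have hm' := nuclearLE_kernel h0 h1 (nuclearLE_dangerLeft h h0) (nuclearLE_dangerRight h h0)
    (σ := s) hs2 hk hρ
  have hl00 : dangerLeft P (0, 0) = 0 := by simp [dangerLeft]
  have hr00 : dangerRight P (0, 0) = 0 := by simp [dangerRight]
  set m := disentanglerKernel (dangerLeft P) (dangerRight P) (-s) k ρ with hmdef
  set m' := disentanglerKernel (dangerLeft P) (dangerRight P) s k ρ with hmdef'
  set T1 : HalfLegs → HalfLegs → ℝ := fun x y => blockHalves A x y -
    if x = (0, (0, 0), 0) ∧ y = (0, (0, 0), 0) then 1 else 0 with hT1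
  have hT1n : NuclearLE T1 (80 * η) := nuclearLE_blockHalves_sub h h0 h1
  have hT := nuclearLE_blockHalves h h0 h1
  have n1 := nuclearLE_blockHalves_remainder h h0 h1
  -- In the expansion of `(1 + m) T (1 + m')`, the kernels are `O(η ^ 2)`. Acting once on `T1 =
  -- O(η)` gives third order, and acting on both sides of `T = O(1)` gives fourth order.
  have n2 := hm.act_left hT1n
  have n3 := hm'.act_right hT1n
  have n4 := hm.act_both hm' hT
  have hs1 : |1 - s| ≤ η ^ 4 := by
    rw [abs_sub_comm]
    exact hs.trans hρ
  -- These are the leftovers of the cancellation: the dangerous diagrams are cancelled with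
  -- coefficient `s` instead of `1`, and each kernel adds `-k * ρ` at the component where all
  -- indices are `0`.
  have n5 := (nuclearLE_dangerLeft_ite h h0).const_mul hs1 (by positivity)
  have n6 := (nuclearLE_dangerRight_ite h h0).const_mul hs1 (by positivity)
  have hkρ : |(-2 * (k * ρ))| ≤ 4 * η ^ 4 := by
    rw [abs_mul, abs_mul, abs_neg, abs_two]
    nlinarith [mul_le_mul hk hρ (abs_nonneg _) (by norm_num)]
  have n7 := (nuclearLE_delta ((0, (0, 0), 0) : HalfLegs) ((0, (0, 0), 0) : HalfLegs)).const_mul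
    hkρ (by positivity)
  refine ((((((n1.add n2).add n3).add n4).add n5).add n6).add n7).mono ?_ |>.congr fun x y => ?_
  -- The constants add up to `60 + 640 + 640 + 64 * 81 + 1 + 1 + 4 = 6530`.
  · have e4 : η ^ 4 ≤ η ^ 3 := pow_le_pow_of_le_one h0.le h1 (by norm_num)
    have e6 : η ^ 6 ≤ η ^ 3 := pow_le_pow_of_le_one h0.le h1 (by norm_num)
    nlinarith
  obtain ⟨r₁, t, l₁⟩ := x
  obtain ⟨r₂, b, l₂⟩ := y
  have rowm : ∀ p, Summable fun q => m p q ^ 2 := fun p =>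
    (hm.normLE.comp (g := fun q : ℕ × ℕ => ((p.1, q.1), (p.2, q.2)))
      (by rintro ⟨_, _⟩ ⟨_, _⟩ h; simp_all)).1
  have colm : ∀ q, Summable fun p => m' p q ^ 2 := fun q =>
    (hm'.normLE.comp (g := fun p : ℕ × ℕ => ((p.1, q.1), (p.2, q.2)))
      (by rintro ⟨_, _⟩ ⟨_, _⟩ h; simp_all)).1
  have sqT : Summable fun z : (ℕ × ℕ) × (ℕ × ℕ) => blockTensor A (z.2, t, z.1, b) ^ 2 :=
    (hT.normLE.comp (g := fun z : (ℕ × ℕ) × (ℕ × ℕ) =>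
      ((z.2.1, t, z.1.1), (z.2.2, b, z.1.2)))
      (by rintro ⟨⟨_, _⟩, _, _⟩ ⟨⟨_, _⟩, _, _⟩ h; simp_all)).1
  have sqT1 : ∀ r : ℕ × ℕ, Summable fun a : ℕ × ℕ => T1 (r.1, t, a.1) (r.2, b, a.2) ^ 2 := fun r =>
    (hT1n.normLE.comp (g := fun a : ℕ × ℕ => ((r.1, t, a.1), (r.2, b, a.2)))
      (by rintro ⟨_, _⟩ ⟨_, _⟩ h; simp_all)).1
  have sqT1' : ∀ l : ℕ × ℕ, Summable fun a : ℕ × ℕ => T1 (a.1, t, l.1) (a.2, b, l.2) ^ 2 := fun l =>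
    (hT1n.normLE.comp (g := fun a : ℕ × ℕ => ((a.1, t, l.1), (a.2, b, l.2)))
      (by rintro ⟨_, _⟩ ⟨_, _⟩ h; simp_all)).1
  have key := tsum_perturbed_basis (rowm (l₁, l₂)) (colm (r₁, r₂)) sqT (l₁, l₂) (r₁, r₂)
  have hS : disentangle R (blockTensor A) ((r₁, r₂), t, (l₁, l₂), b) =
      ∑' z : (ℕ × ℕ) × (ℕ × ℕ), ((if (l₁, l₂) = z.1 then 1 else 0) + m (l₁, l₂) z.1) *
        blockTensor A (z.2, t, z.1, b) *
          ((if z.2 = (r₁, r₂) then 1 else 0) + m' z.2 (r₁, r₂)) := by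
    refine tsum_congr fun z => ?_
    rw [hR, hR']
  rw [key] at hS
  -- The block is the fixed point plus `T1`. On the fixed point only the column `(0, 0)` of `m`
  -- survives, and up to the `k * ρ` term it is `-s` times the left dangerous diagram.
  have sumL : ∑' a, m (l₁, l₂) a * blockTensor A ((r₁, r₂), t, a, b) =
      (if r₁ = 0 ∧ t = (0, 0) ∧ r₂ = 0 ∧ b = (0, 0) then m (l₁, l₂) (0, 0) else 0) +
        ∑' a : ℕ × ℕ, m (l₁, l₂) a * T1 (r₁, t, a.1) (r₂, b, a.2) := by
    have d := hasSum_ite_eq ((0, 0) : ℕ × ℕ)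
      (if r₁ = 0 ∧ t = (0, 0) ∧ r₂ = 0 ∧ b = (0, 0) then m (l₁, l₂) (0, 0) else 0)
    rw [← d.tsum_eq, ← d.summable.tsum_add (summable_mul_of_sq (rowm (l₁, l₂)) (sqT1 (r₁, r₂)))]
    refine tsum_congr fun a => ?_
    obtain ⟨a₁, a₂⟩ := a
    simp only [hT1, blockHalves, Prod.mk.injEq]
    by_cases c : r₁ = 0 ∧ t = (0, 0) ∧ r₂ = 0 ∧ b = (0, 0)
    · obtain ⟨rfl, rfl, rfl, rfl⟩ := c
      by_cases ha : a₁ = 0 ∧ a₂ = 0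
      · obtain ⟨rfl, rfl⟩ := ha
        simp
        ring
      · simp [ha]
    · rw [if_neg c, if_neg (c := (r₁ = 0 ∧ t = (0, 0) ∧ a₁ = 0) ∧ _) (by tauto)]
      simp
  have sumR : ∑' a, m' a (r₁, r₂) * blockTensor A (a, t, (l₁, l₂), b) =
      (if l₁ = 0 ∧ t = (0, 0) ∧ l₂ = 0 ∧ b = (0, 0) then m' (0, 0) (r₁, r₂) else 0) +
        ∑' a : ℕ × ℕ, m' a (r₁, r₂) * T1 (a.1, t, l₁) (a.2, b, l₂) := by
    have d := hasSum_ite_eq ((0, 0) : ℕ × ℕ)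
      (if l₁ = 0 ∧ t = (0, 0) ∧ l₂ = 0 ∧ b = (0, 0) then m' (0, 0) (r₁, r₂) else 0)
    rw [← d.tsum_eq, ← d.summable.tsum_add (summable_mul_of_sq (colm (r₁, r₂)) (sqT1' (l₁, l₂)))]
    refine tsum_congr fun a => ?_
    obtain ⟨a₁, a₂⟩ := a
    simp only [hT1, blockHalves, Prod.mk.injEq]
    by_cases c : l₁ = 0 ∧ t = (0, 0) ∧ l₂ = 0 ∧ b = (0, 0)
    · obtain ⟨rfl, rfl, rfl, rfl⟩ := c
      by_cases ha : a₁ = 0 ∧ a₂ = 0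
      · obtain ⟨rfl, rfl⟩ := ha
        simp
        ring
      · simp [ha]
    · rw [if_neg c, if_neg (c := (a₁ = 0 ∧ t = (0, 0) ∧ l₁ = 0) ∧ _) (by tauto)]
      simp
  have hm0 : m (l₁, l₂) (0, 0) =
      -s * dangerLeft P (l₁, l₂) - k * ρ * (if (l₁, l₂) = (0, 0) then 1 else 0) := by
    simp only [hmdef, disentanglerKernel, hr00, if_true]
    ring
  have hm0' : m' (0, 0) (r₁, r₂) =
      -s * dangerRight P (r₁, r₂) - k * ρ * (if (r₁, r₂) = (0, 0) then 1 else 0) := by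
    simp only [hmdef', disentanglerKernel, hl00, if_true]
    ring
  simp only at hS sumL sumR ⊢
  rw [hS, sumL, sumR]
  simp only [dangerHalves, blockHalves, Prod.mk.eta]
  -- The cancellation itself: the first bracket on the right is minus the dangerous diagrams of the
  -- block.
  have final : (if r₁ = 0 ∧ t = (0, 0) ∧ r₂ = 0 ∧ b = (0, 0) then m (l₁, l₂) (0, 0) else 0) +
      (if l₁ = 0 ∧ t = (0, 0) ∧ l₂ = 0 ∧ b = (0, 0) then m' (0, 0) (r₁, r₂) else 0) =
      -((if r₁ = 0 ∧ t = (0, 0) ∧ r₂ = 0 ∧ b = (0, 0) then dangerLeft P (l₁, l₂) else 0) +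
        if l₁ = 0 ∧ t = (0, 0) ∧ l₂ = 0 ∧ b = (0, 0) then dangerRight P (r₁, r₂) else 0) +
      (1 - s) * (if r₁ = 0 ∧ t = (0, 0) ∧ r₂ = 0 ∧ b = (0, 0) then dangerLeft P (l₁, l₂) else 0) +
      (1 - s) * (if l₁ = 0 ∧ t = (0, 0) ∧ l₂ = 0 ∧ b = (0, 0) then dangerRight P (r₁, r₂) else 0) +
      -2 * (k * ρ) * (if (r₁, t, l₁) = (0, (0, 0), 0) ∧ (r₂, b, l₂) = (0, (0, 0), 0) then 1
        else 0) := by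
    rw [hm0, hm0']
    by_cases ct : t = (0, 0) ∧ b = (0, 0)
    · obtain ⟨rfl, rfl⟩ := ct
      by_cases c1 : r₁ = 0 ∧ r₂ = 0 <;> by_cases c2 : l₁ = 0 ∧ l₂ = 0
      · obtain ⟨rfl, rfl⟩ := c1
        obtain ⟨rfl, rfl⟩ := c2
        simp [hl00, hr00]
        ring
      · obtain ⟨rfl, rfl⟩ := c1
        simp [c2]
        ring
      · obtain ⟨rfl, rfl⟩ := c2
        simp [c1]
        ring
      · have c3 : ¬ ((r₁ = 0 ∧ l₁ = 0) ∧ r₂ = 0 ∧ l₂ = 0) := by tauto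
        simp [c1, c2, c3]
    · have q1 : ∀ u v : Prop, (u ∧ t = (0, 0) ∧ v ∧ b = (0, 0)) ↔ False := by
        intro u v; tauto
      have q2 : ¬ ((r₁, t, l₁) = (0, (0, 0), 0) ∧ (r₂, b, l₂) = (0, (0, 0), 0)) := by
        simp only [Prod.mk.injEq] at ct ⊢
        tauto
      rw [if_neg q2]
      simp [q1]
  linear_combination final


/-! ### Regrouping and change of basis -/

section Bessel

variable {ι κ X Y : Type}

/-- The rows of the table `a` are orthonormal vectors. -/
def OrthonormalTable [DecidableEq ι] (a : ι → X → ℝ) : Prop :=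
  ∀ i j, HasSum (fun x => a i x * a j x) (if i = j then 1 else 0)

theorem OrthonormalTable.summable_sq [DecidableEq ι] {a : ι → X → ℝ} (ha : OrthonormalTable a)
    (i : ι) : Summable fun x => a i x ^ 2 := by
  simpa only [pow_two] using (ha i i).summable

theorem OrthonormalTable.prod [DecidableEq ι] [DecidableEq κ] {a : ι → X → ℝ} {b : κ → Y → ℝ}
    (ha : OrthonormalTable a) (hb : OrthonormalTable b) :
    OrthonormalTable fun (i : ι × κ) (x : X × Y) => a i.1 x.1 * b i.2 x.2 := by
  intro i j
  have h1 := ha i.1 j.1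
  have h2 := hb i.2 j.2
  have h := h1.mul h2 (summable_mul_of_summable_norm h1.summable.norm h2.summable.norm)
  have e : (if i = j then (1 : ℝ) else 0) =
      (if i.1 = j.1 then 1 else 0) * if i.2 = j.2 then 1 else 0 := by
    by_cases hi : i.1 = j.1 <;> by_cases hj : i.2 = j.2 <;> simp [Prod.ext_iff, hi, hj]
  rw [e]
  rwa [show (fun x : X × Y => a i.1 x.1 * b i.2 x.2 * (a j.1 x.1 * b j.2 x.2)) = _ from
    funext fun x => mul_mul_mul_comm _ _ _ _]

theorem orthonormalTable_isometry [DecidableEq ι] (J : L2 ι ≃ₗᵢ[ℝ] L2 X) :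
    OrthonormalTable fun i x => J (basisVec i) x := by
  intro i j
  have h := lp.hasSum_inner (𝕜 := ℝ) (J (basisVec j)) (J (basisVec i))
  rw [LinearIsometryEquiv.inner_map_map, inner_basisVec, basisVec_apply] at h
  exact h

/-- Bessel's inequality for tables. -/
theorem OrthonormalTable.normLE [DecidableEq ι] {a : ι → X → ℝ} (ha : OrthonormalTable a)
    {U : X → ℝ} {c : ℝ} (hU : NormLE U c) : NormLE (fun i => ∑' x, U x * a i x) c := by
  have hv : Orthonormal ℝ
      fun i => (⟨a i, memℓp_two_of_summable (ha.summable_sq i)⟩ : L2 X) := by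
    rw [orthonormal_iff_ite]
    intro i j
    refine Eq.trans (tsum_congr fun x => ?_) (ha i j).tsum_eq
    exact mul_comm _ _
  obtain ⟨f, hf, hfc⟩ := hU.exists_L2
  rw [normLE_iff_finset]
  refine ⟨hU.nonneg, fun s => le_trans (Finset.sum_le_sum fun i _ => ?_)
    ((hv.sum_inner_products_le f (s := s)).trans (pow_le_pow_left₀ (norm_nonneg _) hfc 2))⟩
  rw [Real.norm_eq_abs, sq_abs]
  refine le_of_eq (congrArg (· ^ 2) (tsum_congr fun x => ?_))
  rw [← hf]
  rfl

end Bessel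

section Regroup

variable {α β γ : Type} [DecidableEq α] [DecidableEq β] [DecidableEq γ]

/-- The contraction of two perturbations of the fixed point, whose first-order parts are not
contracted with the fixed point. -/
theorem normLE_contract_perturbed {E e₁ e₂ : α → γ → ℝ} {F f₁ f₂ : β → γ → ℝ} {x₀ : α} {y₀ : β}
    {z₀ : γ} {a b : ℝ}
    (hE : ∀ x z, E x z = (if x = x₀ ∧ z = z₀ then 1 else 0) + e₁ x z + e₂ x z)
    (hF : ∀ y z, F y z = (if y = y₀ ∧ z = z₀ then 1 else 0) + f₁ y z + f₂ y z)
    (he₁ : ∀ x, e₁ x z₀ = 0) (hf₁ : ∀ y, f₁ y z₀ = 0)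
    (ne₁ : NormLE (fun p : α × γ => e₁ p.1 p.2) a) (ne₂ : NormLE (fun p : α × γ => e₂ p.1 p.2) b)
    (nf₁ : NormLE (fun p : β × γ => f₁ p.1 p.2) a) (nf₂ : NormLE (fun p : β × γ => f₂ p.1 p.2) b) :
    NormLE (fun p : α × β => (∑' z, E p.1 z * F p.2 z) - if p = (x₀, y₀) then 1 else 0)
      (a * a + b * (1 + a + b) + (1 + a) * b) := by
  have nd : ∀ {δ : Type} [DecidableEq δ] (w : δ),
      NormLE (fun p : δ × γ => if p.1 = w ∧ p.2 = z₀ then (1 : ℝ) else 0) 1 := by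
    intro δ _ w
    refine normLE_indicator (fun p : δ × γ => p.1 = w ∧ p.2 = z₀) ?_
    rintro ⟨_, _⟩ ⟨_, _⟩ ⟨rfl, rfl⟩ ⟨rfl, rfl⟩
    rfl
  have nF : NormLE (fun p : β × γ => F p.1 p.2) (1 + a + b) :=
    (((nd y₀).add nf₁).add nf₂).congr fun p => by rw [hF]
  have ne := (nd x₀).add ne₁
  -- The product splits as `d d' + e₁ f₁ + e₂ F + (d + e₁) f₂` with fixed-point parts `d`, `d'`. The
  -- cross terms `d f₁` and `e₁ d'` vanish because `e₁` and `f₁` are zero at `z₀`.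
  have c1 := NormLE.contract (E := e₁) (F := f₁) ne₁ nf₁
  have c2 := NormLE.contract (E := e₂) (F := F) ne₂ nF
  have c3 := NormLE.contract (E := fun x z => (if x = x₀ ∧ z = z₀ then 1 else 0) + e₁ x z)
    (F := f₂) ne nf₂
  refine ((c1.add c2).add c3).congr ?_
  rintro ⟨x, y⟩
  have s1 := NormLE.summable_contract (E := e₁) (F := f₁) ne₁ nf₁ x y
  have s2 := NormLE.summable_contract (E := e₂) (F := F) ne₂ nF x y
  have s3 := NormLE.summable_contract
    (E := fun x z => (if x = x₀ ∧ z = z₀ then 1 else 0) + e₁ x z) (F := f₂) ne nf₂ x y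
  have s4 := hasSum_ite_eq z₀ (if (x, y) = (x₀, y₀) then (1 : ℝ) else 0)
  simp only
  rw [← s1.tsum_add s2, ← (s1.add s2).tsum_add s3, sub_eq_iff_eq_add, ← s4.tsum_eq,
    ← ((s1.add s2).add s3).tsum_add s4.summable]
  refine tsum_congr fun z => ?_
  rw [hE, hF]
  by_cases hz : z = z₀
  · subst hz
    rw [he₁, hf₁]
    by_cases hx : x = x₀ <;> by_cases hy : y = y₀ <;> simp [hx, hy] <;> ring
  · simp [hz]
    ring

end Regroup

/-! ### Change of basis on the bonds. -/

section ContractIso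

variable {β : Type} {J : L2 ℕ ≃ₗᵢ[ℝ] L2 (ℕ × ℕ)} {Φ : L2 ℕ ≃ₗᵢ[ℝ] L2 β} {w : β}

/-- The table with entries `J_i ⊗ Φ_j ⊗ J_k ⊗ Φ_l`. -/
noncomputable def isoTable (J : L2 ℕ ≃ₗᵢ[ℝ] L2 (ℕ × ℕ)) (Φ : L2 ℕ ≃ₗᵢ[ℝ] L2 β) (x : Four ℕ ℕ)
    (y : Four (ℕ × ℕ) β) : ℝ :=
  J (basisVec x.1) y.1 * (Φ (basisVec x.2.1) y.2.1 *
    (J (basisVec x.2.2.1) y.2.2.1 * Φ (basisVec x.2.2.2) y.2.2.2))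

theorem orthonormalTable_isoTable : OrthonormalTable (isoTable J Φ) :=
  OrthonormalTable.prod (a := fun i x => J (basisVec i) x)
    (b := fun (i : ℕ × ℕ × ℕ) (x : β × (ℕ × ℕ) × β) =>
      Φ (basisVec i.1) x.1 * (J (basisVec i.2.1) x.2.1 * Φ (basisVec i.2.2) x.2.2))
    (orthonormalTable_isometry J)
    (OrthonormalTable.prod (a := fun i x => Φ (basisVec i) x)
      (b := fun (i : ℕ × ℕ) (x : (ℕ × ℕ) × β) => J (basisVec i.1) x.1 * Φ (basisVec i.2) x.2)
      (orthonormalTable_isometry Φ)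
      (OrthonormalTable.prod (a := fun i x => J (basisVec i) x) (b := fun i x => Φ (basisVec i) x)
        (orthonormalTable_isometry J) (orthonormalTable_isometry Φ)))

theorem contractIso_eq (U : Four (ℕ × ℕ) β → ℝ) (x : Four ℕ ℕ) :
    contractIso J Φ U x = ∑' y, U y * isoTable J Φ x y := by
  obtain ⟨i, j, k, l⟩ := x
  refine tsum_congr fun y => ?_
  simp only [isoTable]
  ring

theorem isoTable_zero [DecidableEq β] (hJ : J (basisVec 0) = basisVec (0, 0))
    (hΦ : Φ (basisVec 0) = basisVec w) (y : Four (ℕ × ℕ) β) :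
    isoTable J Φ (0, 0, 0, 0) y = if y = ((0, 0), w, (0, 0), w) then 1 else 0 := by
  obtain ⟨y₁, y₂, y₃, y₄⟩ := y
  simp only [isoTable, hJ, hΦ, basisVec_apply, Prod.mk.injEq]
  split_ifs <;> simp_all

theorem contractIso_zero [DecidableEq β] (hJ : J (basisVec 0) = basisVec (0, 0))
    (hΦ : Φ (basisVec 0) = basisVec w) (U : Four (ℕ × ℕ) β → ℝ) :
    contractIso J Φ U (0, 0, 0, 0) = U ((0, 0), w, (0, 0), w) := by
  rw [contractIso_eq, tsum_eq_single ((0, 0), w, (0, 0), w)]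
  · simp [isoTable_zero hJ hΦ]
  · intro y hy
    simp [isoTable_zero hJ hΦ, hy]

/-- Because the isometries fix the vectors labelled `0`, the fixed point is the row `0000` of
`isoTable`, and by orthonormality it is sent to `highTemp`. Bessel's inequality then applies to the
difference. -/
theorem normLE_contractIso_sub [DecidableEq β] (hJ : J (basisVec 0) = basisVec (0, 0))
    (hΦ : Φ (basisVec 0) = basisVec w) {U : Four (ℕ × ℕ) β → ℝ} {t c : ℝ}
    (hU : NormLE (fun y => U y - t * if y = ((0, 0), w, (0, 0), w) then 1 else 0) c) :
    NormLE (fun x => contractIso J Φ U x - t * highTemp x) c := by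
  have on := orthonormalTable_isoTable (J := J) (Φ := Φ)
  refine (on.normLE hU).congr fun x => ?_
  have s1 := (on x (0, 0, 0, 0)).mul_left t
  have s2 := summable_mul_of_sq hU.1 (on.summable_sq x)
  rw [contractIso_eq, highTemp, sub_eq_iff_eq_add, ← s1.tsum_eq, ← s2.tsum_add s1.summable]
  refine tsum_congr fun y => ?_
  rw [isoTable_zero hJ hΦ]
  ring

end ContractIso

theorem tsum_option_eq {β : Type} (f : Option β → ℝ) (hf : Summable fun b => f (some b)) :
    ∑' s, f s = f none + ∑' b, f (some b) := by
  rw [← (Equiv.optionEquivSumPUnit.{0} β).symm.tsum_eq f, Summable.tsum_sum]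
  · rw [add_comm]
    congr 1
    simp
  · exact hf
  · exact (hasSum_fintype _).summable

/-- Neither the fixed point nor the first-order part contributes, so the product term is only of
fourth order on the dangerous components. -/
theorem row_zero_eq_rowSecond (h : IsA3Decomposition 1 η A P Q) (h0 : 0 < η) (h1 : η ≤ 1)
    {r l : ℕ} (hrl : ¬ (r = 0 ∧ l = 0)) :
    rowTensor A A (r, (0, 0), l) (0, 0) = rowSecond P Q (r, (0, 0), l) (0, 0) := by
  rw [rowTensor_eq h h0 h1, rowFirst_zero h, rowDelta, if_neg (by simpa using hrl)]
  ring

/-- The part of a row with all inner vertical bonds in the state `0`. -/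
theorem NormLE.row_zero {f : HalfLegs → ℕ × ℕ → ℝ} {c : ℝ}
    (hf : NormLE (fun p : HalfLegs × ℕ × ℕ => f p.1 p.2) c) : NormLE (fun x => f x (0, 0)) c :=
  hf.comp (g := fun x => (x, (0, 0))) fun _ _ h => (Prod.mk.inj h).1

/-- A half-disc whose component in the state `none` of the internal bond is that of the row of
`A`. -/
noncomputable def halfDisc {δ : Type} (A : Four ℕ ℕ → ℝ) (u : HalfLegs → δ → ℝ) (x : HalfLegs) :
    Option δ → ℝ
  | none => rowTensor A A x (0, 0)
  | some g => u x g

/-- The first-order part of a half-disc. -/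
def halfDiscFirst (δ : Type) (P : Four ℕ ℕ → ℝ) (x : HalfLegs) : Option δ → ℝ
  | none => rowFirst P x (0, 0)
  | some _ => 0

/-- The part of a half-disc of higher order. -/
noncomputable def halfDiscRest {δ : Type} (P Q : Four ℕ ℕ → ℝ) (u : HalfLegs → δ → ℝ)
    (x : HalfLegs) : Option δ → ℝ
  | none => rowSecond P Q x (0, 0)
  | some g => u x g

/-! ### Half-discs and the regrouped tensor. -/

section HalfDisc

variable {δ : Type} {u : HalfLegs → δ → ℝ} {c : ℝ}

theorem NormLE.option {f : HalfLegs → ℝ} {a b : ℝ} (hf : NormLE f a)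
    (hu : NormLE (fun p : HalfLegs × δ => u p.1 p.2) b) {v : HalfLegs → Option δ → ℝ}
    (hv : ∀ x, v x none = f x) (hv' : ∀ x g, v x (some g) = u x g) :
    NormLE (fun p : HalfLegs × Option δ => v p.1 p.2) (a + b) := by
  classical
  have h1 : NormLE (fun p : HalfLegs × Option δ => if p.2 = none then f p.1 else 0) a := by
    refine hf.of_injOn Prod.fst {p | p.2 = none} ?_ ?_ ?_
    · rintro ⟨x, s⟩ hs ⟨y, s'⟩ hs' hxy
      simp_all
    · rintro ⟨x, s⟩ hs
      simp_all
    · rintro ⟨x, s⟩ hs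
      exact if_neg hs
  have h2 : NormLE (fun p : HalfLegs × Option δ => if p.2 = none then 0 else v p.1 p.2) b := by
    rcases isEmpty_or_nonempty δ with hδ | ⟨⟨d⟩⟩
    · refine normLE_iff_finset.2 ⟨hu.nonneg, fun s => ?_⟩
      have : ∀ o : Option δ, o = none := fun o => by
        rcases o with _ | g
        · rfl
        · exact hδ.elim g
      simp only [this, if_true]
      simpa using sq_nonneg b
    -- The default `d` is never reached on the set where the bond index is not `none`.
    · refine hu.of_injOn (fun p => (p.1, p.2.getD d)) {p | p.2 ≠ none} ?_ ?_ ?_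
      · rintro ⟨x, s⟩ hs ⟨y, s'⟩ hs' hxy
        rcases s with _ | s <;> rcases s' with _ | s' <;> simp_all
      · rintro ⟨x, s⟩ hs
        rcases s with _ | s
        · exact (hs rfl).elim
        · simp [hv']
      · rintro ⟨x, s⟩ hs
        exact if_pos (not_not.1 hs)
  refine (h1.add h2).congr ?_
  rintro ⟨x, _ | g⟩
  · simp [hv]
  · simp

theorem halfDisc_eq (h : IsA3Decomposition 1 η A P Q) (h0 : 0 < η) (h1 : η ≤ 1) (x : HalfLegs)
    (s : Option δ) [DecidableEq δ] : halfDisc A u x s =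
      (if x = (0, (0, 0), 0) ∧ s = none then 1 else 0) + halfDiscFirst δ P x s +
        halfDiscRest P Q u x s := by
  rcases s with _ | g
  · simp [halfDisc, halfDiscFirst, halfDiscRest, rowTensor_eq h h0 h1, rowDelta]
  · simp [halfDisc, halfDiscFirst, halfDiscRest]

/-- The vanishing condition required by `normLE_contract_perturbed`: after regrouping, the outer
vertical pair is the contracted bond. -/
theorem halfDiscFirst_zero (h : IsA3Decomposition 1 η A P Q) (r l : ℕ) (s : Option δ) :
    halfDiscFirst δ P (r, (0, 0), l) s = 0 := by
  rcases s with _ | g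
  · exact rowFirst_zero h r l
  · rfl

theorem normLE_halfDiscFirst (h : IsA3Decomposition 1 η A P Q) :
    NormLE (fun p : HalfLegs × Option δ => halfDiscFirst δ P p.1 p.2) (2 * η) := by
  have hz : NormLE (fun p : HalfLegs × δ => (fun _ _ => (0 : ℝ) : HalfLegs → δ → ℝ) p.1 p.2) 0 :=
    normLE_iff_finset.2 ⟨le_rfl, by simp⟩
  have := NormLE.option (f := fun x => rowFirst P x (0, 0)) (u := fun _ _ => 0)
    (v := halfDiscFirst δ P) (NormLE.row_zero (f := rowFirst P) (normLE_rowFirst h)) hz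
    (fun _ => rfl) fun _ _ => rfl
  rwa [add_zero] at this

theorem normLE_halfDiscRest (h : IsA3Decomposition 1 η A P Q) (h0 : 0 < η) (h1 : η ≤ 1)
    (hu : NormLE (fun p : HalfLegs × δ => u p.1 p.2) c) :
    NormLE (fun p : HalfLegs × Option δ => halfDiscRest P Q u p.1 p.2) (6 * η ^ 2 + c) :=
  NormLE.option (f := fun x => rowSecond P Q x (0, 0)) (u := u) (v := halfDiscRest P Q u)
    (NormLE.row_zero (f := rowSecond P Q) (normLE_rowSecond h h0 h1)) hu (fun _ => rfl)
    fun _ _ => rfl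

/-- The regrouped tensor is a perturbation of the fixed point. -/
theorem normLE_regroup_sub (h : IsA3Decomposition 1 η A P Q) (h0 : 0 < η) (h1 : η ≤ 1)
    [DecidableEq δ] {v : HalfLegs → δ → ℝ}
    (hu : NormLE (fun p : HalfLegs × δ => u p.1 p.2) c)
    (hv : NormLE (fun p : HalfLegs × δ => v p.1 p.2) c) :
    NormLE (fun y : Four (ℕ × ℕ) (Option δ) =>
      regroup (fun x => halfDisc A u (x.1, x.2.1, x.2.2.1) x.2.2.2)
        (fun x => halfDisc (flipVert A) v (x.1, x.2.2.2, x.2.2.1) x.2.1) y -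
        if y = ((0, 0), none, (0, 0), none) then 1 else 0)
      (4 * η ^ 2 + (6 * η ^ 2 + c) * (2 + 4 * η + (6 * η ^ 2 + c))) := by
  have h' := h.flipVert
  have i1 : Function.Injective fun p : (ℕ × Option δ × ℕ) × (ℕ × ℕ) =>
      (((p.1.1, p.2, p.1.2.2), p.1.2.1) : HalfLegs × Option δ) := by
    rintro ⟨⟨_, _, _⟩, _⟩ ⟨⟨_, _, _⟩, _⟩ h
    simp_all
  have i2 : Function.Injective fun p : (ℕ × ℕ × Option δ) × (ℕ × ℕ) =>
      (((p.1.1, p.2, p.1.2.1), p.1.2.2) : HalfLegs × Option δ) := by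
    rintro ⟨⟨_, _, _⟩, _⟩ ⟨⟨_, _, _⟩, _⟩ h
    simp_all
  have n1 := (normLE_halfDiscFirst (δ := δ) h').comp i1
  have n2 := (normLE_halfDiscRest (u := v) h' h0 h1 hv).comp i1
  have n3 := (normLE_halfDiscFirst (δ := δ) h).comp i2
  have n4 := (normLE_halfDiscRest (u := u) h h0 h1 hu).comp i2
  -- Here `a = 2 * η` and `b = 6 * η ^ 2 + c`, where `c` is the size of the new channels.
  have key := normLE_contract_perturbed (α := ℕ × Option δ × ℕ) (β := ℕ × ℕ × Option δ)
    (E := fun x z => halfDisc (flipVert A) v (x.1, z, x.2.2) x.2.1)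
    (F := fun y z => halfDisc A u (y.1, z, y.2.1) y.2.2)
    (e₁ := fun x z => halfDiscFirst δ (flipVert P) (x.1, z, x.2.2) x.2.1)
    (e₂ := fun x z => halfDiscRest (flipVert P) (flipVert Q) v (x.1, z, x.2.2) x.2.1)
    (f₁ := fun y z => halfDiscFirst δ P (y.1, z, y.2.1) y.2.2)
    (f₂ := fun y z => halfDiscRest P Q u (y.1, z, y.2.1) y.2.2)
    (x₀ := (0, none, 0)) (y₀ := (0, 0, none)) (z₀ := (0, 0))
    (fun x z => by
      rw [halfDisc_eq h' h0 h1]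
      congr 2
      refine if_congr ?_ rfl rfl
      obtain ⟨_, _, _⟩ := x
      simp only [Prod.mk.injEq]
      tauto)
    (fun x z => by
      rw [halfDisc_eq h h0 h1]
      congr 2
      refine if_congr ?_ rfl rfl
      obtain ⟨_, _, _⟩ := x
      simp only [Prod.mk.injEq]
      tauto)
    (fun x => halfDiscFirst_zero h' x.1 x.2.2 x.2.1)
    (fun y => halfDiscFirst_zero h y.1 y.2.1 y.2.2)
    n1 n2 n3 n4
  refine ((key.comp (g := fun y : Four (ℕ × ℕ) (Option δ) =>
    ((y.1.1, y.2.1, y.2.2.1.1), (y.1.2, y.2.2.1.2, y.2.2.2))) ?_).mono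
      (le_of_eq (by ring))).congr ?_
  · rintro ⟨⟨_, _⟩, _, ⟨_, _⟩, _⟩ ⟨⟨_, _⟩, _, ⟨_, _⟩, _⟩ h
    simp_all
  · rintro ⟨⟨r₁, r₂⟩, s, ⟨l₁, l₂⟩, s'⟩
    simp only [regroup]
    congr 1
    refine if_congr ?_ rfl rfl
    simp only [Prod.mk.injEq]
    tauto

/-- The leading component of the regrouped tensor. -/
theorem abs_regroup_zero_sub_one_le (h : IsA3Decomposition 1 η A P Q) (h0 : 0 < η) (h1 : η ≤ 1)
    {v : HalfLegs → δ → ℝ} :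
    |regroup (fun x => halfDisc A u (x.1, x.2.1, x.2.2.1) x.2.2.2)
        (fun x => halfDisc (flipVert A) v (x.1, x.2.2.2, x.2.2.1) x.2.1)
        ((0, 0), none, (0, 0), none) - 1| ≤ 76 * η ^ 2 := by
  have hz : NormLE (fun p : HalfLegs × Empty =>
      (fun _ _ => (0 : ℝ) : HalfLegs → Empty → ℝ) p.1 p.2) 0 :=
    normLE_iff_finset.2 ⟨le_rfl, by simp⟩
  -- At this component both internal bonds are `none`, so the value does not depend on `u` and `v`.
  -- The bound can therefore be taken with no new channel at all, `c = 0`, which gives `η ^ 2`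
  -- instead of `η ^ (3/2)`; `4 + 6 * (2 + 4 + 6) = 76`.
  have := (normLE_regroup_sub (δ := Empty) (u := fun _ _ => 0) (v := fun _ _ => 0)
    h h0 h1 hz hz).apply_le ((0, 0), none, (0, 0), none)
  rw [if_pos rfl] at this
  refine le_trans this ?_
  have : η ^ 2 ≤ 1 := pow_le_one₀ h0.le h1
  nlinarith

end HalfDisc


/-! ### Assembly of the renormalization step. -/

variable {K ε : ℝ}

/-- The constant of A3 is absorbed into the small parameter `η = K' * ε`. The bound on `Q` needs `K
≤ K' ^ 2`, hence `1 ≤ K'`. -/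
theorem IsA3Decomposition.rescale {K' : ℝ} (h : IsA3Decomposition K ε A P Q) (hε : 0 ≤ ε)
    (hK : K ≤ K') (h1 : 1 ≤ K') : IsA3Decomposition 1 (K' * ε) A P Q where
  normalized := h.normalized
  sum_eq := h.sum_eq
  one_circle := h.one_circle.mono (by nlinarith)
  two_circle := h.two_circle.mono (by
    have : K ≤ K' ^ 2 := hK.trans (le_self_pow₀ h1 two_ne_zero)
    nlinarith [sq_nonneg ε])
  corner := h.corner

theorem normLE_of_nuclearLE_pair {f : ℕ × ℕ → ℝ} {c : ℝ}
    (h : NuclearLE (fun i j => f (i, j)) c) : NormLE f c :=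
  h.normLE

/-- The dangerous diagrams of a table that is a product up to a nuclear remainder. -/
theorem normLE_danger (h : IsA3Decomposition 1 η A P Q) (h0 : 0 < η) (h1 : η ≤ 1)
    {S : Four (ℕ × ℕ) (ℕ × ℕ) → ℝ} {c : ℝ}
    (hS : NuclearLE (fun x y => S ((x.1, y.1), x.2.1, (x.2.2, y.2.2), y.2.1) -
      rowTensor A A x (0, 0) * rowTensor (flipVert A) (flipVert A) y (0, 0)) c)
    {f : ℕ → ℕ × ℕ} (hf : ∀ i, i ≠ 0 → ¬ ((f i).1 = 0 ∧ (f i).2 = 0))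
    (hfi : Function.Injective f) :
    NormLE (fun p : {p : ℕ × ℕ // p.1 ≠ 0 ∧ p.2 ≠ 0} =>
      S (((f p.1.1).1, (f p.1.2).1), (0, 0), ((f p.1.1).2, (f p.1.2).2), (0, 0)))
      (36 * η ^ 4 + c) := by
  have inj : Function.Injective fun i => (((f i).1, (0, 0), (f i).2) : HalfLegs) := by
    intro i j hij
    simp only [Prod.mk.injEq] at hij
    exact hfi (Prod.ext hij.1 hij.2.2)
  have n1 := NormLE.row_zero (f := rowSecond P Q) (normLE_rowSecond h h0 h1)
  have n2 := NormLE.row_zero (f := rowSecond (flipVert P) (flipVert Q))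
    (normLE_rowSecond h.flipVert h0 h1)
  have n3 := ((n1.comp inj).mul (n2.comp inj)).comp
    (g := fun p : {p : ℕ × ℕ // p.1 ≠ 0 ∧ p.2 ≠ 0} => p.1) Subtype.val_injective
  have n4 := hS.normLE.comp (g := fun p : {p : ℕ × ℕ // p.1 ≠ 0 ∧ p.2 ≠ 0} =>
    ((((f p.1.1).1, (0, 0), (f p.1.1).2) : HalfLegs),
      (((f p.1.2).1, (0, 0), (f p.1.2).2) : HalfLegs))) (by
      rintro p q hpq
      exact Subtype.ext (Prod.ext (inj (Prod.mk.inj hpq).1) (inj (Prod.mk.inj hpq).2)))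
  -- On these components both factors of the product term are of second order, whence `6 * 6 * η ^
  -- 4`. The map `f` places the nonzero index on the left or on the right leg, so that one argument
  -- treats both diagrams.
  refine ((n3.add n4).mono (by nlinarith)).congr fun p => ?_
  simp only
  rw [row_zero_eq_rowSecond h h0 h1 (hf _ p.2.1),
    row_zero_eq_rowSecond h.flipVert h0 h1 (hf _ p.2.2)]
  ring

/-- The bond state `none` carries the product term and the states `some` carry the factorized
remainder. -/
theorem joinHalves_halfDisc {δ : Type} {S : Four (ℕ × ℕ) (ℕ × ℕ) → ℝ} {u v : HalfLegs → δ → ℝ}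
    {c d : ℝ} (hu : NormLE (fun p : HalfLegs × δ => u p.1 p.2) c)
    (hv : NormLE (fun p : HalfLegs × δ => v p.1 p.2) d)
    (hS : ∀ x y : HalfLegs, S ((x.1, y.1), x.2.1, (x.2.2, y.2.2), y.2.1) -
      rowTensor A A x (0, 0) * rowTensor (flipVert A) (flipVert A) y (0, 0) =
        ∑' s, u x s * v y s) :
    S = joinHalves (fun x => halfDisc A u (x.1, x.2.1, x.2.2.1) x.2.2.2)
      (fun x => halfDisc (flipVert A) v (x.1, x.2.2.2, x.2.2.1) x.2.1) := by
  funext z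
  obtain ⟨⟨r₁, r₂⟩, t, ⟨l₁, l₂⟩, b⟩ := z
  have h := hS (r₁, t, l₁) (r₂, b, l₂)
  simp only [joinHalves]
  rw [tsum_option_eq _ (hu.summable_contract (E := u) (F := v) hv (r₁, t, l₁) (r₂, b, l₂))]
  simp only [halfDisc]
  linarith

/-- The result of the step, after the change of basis and normalization. -/
theorem satisfiesA1_contractIso {β : Type} [DecidableEq β] {J : L2 ℕ ≃ₗᵢ[ℝ] L2 (ℕ × ℕ)}
    {Φ : L2 ℕ ≃ₗᵢ[ℝ] L2 β} {w : β} {U : Four (ℕ × ℕ) β → ℝ} {a c C ε' : ℝ}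
    (hJ : J (basisVec 0) = basisVec (0, 0)) (hΦ : Φ (basisVec 0) = basisVec w)
    (ha : |U ((0, 0), w, (0, 0), w) - 1| ≤ a) (ha2 : a ≤ 1 / 2)
    (hU : NormLE (fun y => U y - if y = ((0, 0), w, (0, 0), w) then 1 else 0) c)
    (hC : 2 * (c + a) ≤ C * ε') :
    SatisfiesA1 C ε' fun x =>
      (contractIso J Φ U (0, 0, 0, 0))⁻¹ * contractIso J Φ U x := by
  have hN : contractIso J Φ U (0, 0, 0, 0) = U ((0, 0), w, (0, 0), w) := contractIso_zero hJ hΦ U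
  set N : ℝ := U ((0, 0), w, (0, 0), w)
  have hN2 : 1 / 2 ≤ N := by linarith [(abs_le.1 ha).1]
  have hN0 : N ≠ 0 := by linarith
  refine ⟨by simp only [hN]; exact inv_mul_cancel₀ hN0, ?_⟩
  have nd : NormLE (fun y : Four (ℕ × ℕ) β =>
      if y = ((0, 0), w, (0, 0), w) then (1 : ℝ) else 0) 1 :=
    normLE_indicator (fun y : Four (ℕ × ℕ) β => y = ((0, 0), w, (0, 0), w))
      fun _ _ h h' => h.trans h'.symm
  -- Replacing the reference value `1` by the actual leading component `N` costs at most `a`; the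
  -- normalization by `N⁻¹` costs a factor `2`.
  have hU' : NormLE (fun y => U y - N * if y = ((0, 0), w, (0, 0), w) then 1 else 0) (c + a * 1) :=
    (hU.add (nd.const_mul (t := 1 - N) (by rwa [abs_sub_comm]))).congr fun y => by ring
  have hinv : |N⁻¹| ≤ 2 := by
    rw [abs_inv, abs_of_pos (by linarith)]
    exact inv_le_of_inv_le₀ (by norm_num) (by linarith)
  refine (((normLE_contractIso_sub hJ hΦ hU').const_mul hinv).mono (by linarith)).congr fun x => ?_
  rw [hN]
  field_simp

/-- Comparison of the powers of `K' ε` with those of `ε`. -/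
theorem sqrt_mul_pow_three_le {K' : ℝ} (h1 : 1 ≤ K') (hε : 0 ≤ ε) :
    √((K' * ε) ^ 3) ≤ K' ^ 3 * ε ^ (3 / 2 : ℝ) := by
  have h2 : √(ε ^ 3) = ε ^ (3 / 2 : ℝ) := by
    rw [Real.sqrt_eq_rpow, ← Real.rpow_natCast, ← Real.rpow_mul hε]
    norm_num
  have h3 : (1 : ℝ) ≤ K' ^ 3 := one_le_pow₀ h1
  rw [mul_pow, Real.sqrt_mul (by positivity), h2]
  refine mul_le_mul_of_nonneg_right ?_ (by positivity)
  rw [Real.sqrt_le_left (by positivity)]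
  nlinarith

end TensorRG

open TensorRG in
theorem proposition3 :
    ∃ N : ℕ, 1 ≤ N ∧ ∀ K : ℝ, 0 < K → ∃ ε₀ : ℝ, 0 < ε₀ ∧ ∃ C : ℝ, 0 < C ∧
      ∀ ε : ℝ, 0 < ε → ε ≤ ε₀ → ∀ A P Q : Four ℕ ℕ → ℝ, IsA3Decomposition K ε A P Q →
        ∃ (B : L2 (ℕ × ℕ) →L[ℝ] L2 (ℕ × ℕ)) (R : L2 (ℕ × ℕ) ≃L[ℝ] L2 (ℕ × ℕ))
          (Su : ℕ × (ℕ × ℕ) × ℕ × Bond N → ℝ) (Sd : ℕ × Bond N × ℕ × (ℕ × ℕ) → ℝ),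
          -- the disentangler
          IsDisentanglerGenerator P B ∧ ‖B‖ ≤ C * ε ^ 2 ∧
          (R : L2 (ℕ × ℕ) →L[ℝ] L2 (ℕ × ℕ)) = NormedSpace.exp B ∧
          -- it cancels the two dangerous diagrams up to a third-order remainder
          NormLE (fun p : {p : ℕ × ℕ // p.1 ≠ 0 ∧ p.2 ≠ 0} =>
            disentangle R (blockTensor A) ((0, 0), (0, 0), p.1, (0, 0))) (C * ε ^ 3) ∧
          NormLE (fun p : {p : ℕ × ℕ // p.1 ≠ 0 ∧ p.2 ≠ 0} =>
            disentangle R (blockTensor A) (p.1, (0, 0), (0, 0), (0, 0))) (C * ε ^ 3) ∧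
          -- the splitting, with the sizes of the half-discs
          disentangle R (blockTensor A) = joinHalves Su Sd ∧
          NormLE (fun x : ℕ × (ℕ × ℕ) × ℕ => Su (x.1, x.2.1, x.2.2, none)) C ∧
          NormLE (fun x : ℕ × ℕ × (ℕ × ℕ) => Sd (x.1, none, x.2.1, x.2.2)) C ∧
          NormLE (fun x : ℕ × (ℕ × ℕ) × ℕ × (Fin N × ℕ) =>
            Su (x.1, x.2.1, x.2.2.1, some x.2.2.2)) (C * ε ^ (3 / 2 : ℝ)) ∧
          NormLE (fun x : ℕ × (Fin N × ℕ) × ℕ × (ℕ × ℕ) =>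
            Sd (x.1, some x.2.1, x.2.2.1, x.2.2.2)) (C * ε ^ (3 / 2 : ℝ)) ∧
          -- the result of the step, for all admissible identifications of the bond spaces
          ∀ (J : L2 ℕ ≃ₗᵢ[ℝ] L2 (ℕ × ℕ)) (Φ : L2 ℕ ≃ₗᵢ[ℝ] L2 (Bond N)),
            J (basisVec 0) = basisVec (0, 0) → Φ (basisVec 0) = basisVec none →
            |contractIso J Φ (regroup Su Sd) (0, 0, 0, 0) - 1| ≤ C * ε ^ 2 ∧
            SatisfiesA1 C (ε ^ (3 / 2 : ℝ)) (fun x =>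
              (contractIso J Φ (regroup Su Sd) (0, 0, 0, 0))⁻¹ *
                contractIso J Φ (regroup Su Sd) x) := by
  -- One infinite-dimensional channel suffices, because all remainder terms have been gathered into
  -- a single nuclear table.
  refine ⟨1, le_rfl, fun K hK => ?_⟩
  set K' : ℝ := max K 1 with hK'
  have hK1 : 1 ≤ K' := le_max_right _ _
  have hK0 : 0 < K' := by linarith
  -- The bound on `ε` gives `η ≤ 1 / 20`, so that `76 * η ^ 2 ≤ 1 / 2` and the leading component is
  -- invertible. The constant `30000` is dictated by the last estimate, and `K' ^ 3` by the
  -- conversion of powers of `η` into powers of `ε`.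
  refine ⟨1 / (20 * K'), by positivity, 30000 * K' ^ 3, by positivity, ?_⟩
  intro ε hε hε0 A P Q hA
  have h := hA.rescale hε.le (le_max_left K 1) hK1
  rw [← hK'] at h
  have h0 : 0 < K' * ε := by positivity
  have h20 : K' * ε ≤ 1 / 20 := by
    have := mul_le_mul_of_nonneg_left hε0 hK0.le
    have e : K' * (1 / (20 * K')) = 1 / 20 := by field_simp
    linarith
  have τle := sqrt_mul_pow_three_le hK1 hε.le
  have η2 : (K' * ε) ^ 2 ≤ K' ^ 3 * ε ^ 2 := by
    rw [mul_pow]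
    exact mul_le_mul_of_nonneg_right (pow_le_pow_right₀ hK1 (by norm_num)) (by positivity)
  have η3 : (K' * ε) ^ 3 = K' ^ 3 * ε ^ 3 := mul_pow _ _ _
  have hK3 : 1 ≤ K' ^ 3 := one_le_pow₀ hK1
  generalize K' * ε = η at h h0 h20 τle η2 η3
  have h1 : η ≤ 1 := by linarith
  have η2pos : 0 ≤ η ^ 2 := by positivity
  have η3pos : 0 ≤ η ^ 3 := by positivity
  have hη2 : η ^ 2 ≤ 1 / 400 := by nlinarith
  have hη4 : η ^ 4 ≤ η ^ 3 := pow_le_pow_of_le_one h0.le h1 (by norm_num)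
  obtain ⟨l, hl, hln⟩ := (normLE_of_nuclearLE_pair (nuclearLE_dangerLeft h h0)).exists_L2
  obtain ⟨r, hr, hrn⟩ := (normLE_of_nuclearLE_pair (nuclearLE_dangerRight h h0)).exists_L2
  obtain ⟨B, R, s, k, ρ, hB, hBm, hRB, hρ, hs, hk, hR, hR'⟩ :=
    exists_disentangler (by linarith) hln hrn (by rw [hl]; simp [dangerLeft])
      (by rw [hr]; simp [dangerRight])
  have hl' : (l : ℕ × ℕ → ℝ) = dangerLeft P := funext hl
  have hr' : (r : ℕ × ℕ → ℝ) = dangerRight P := funext hr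
  rw [hl', hr'] at hR hR' hBm
  rw [← pow_mul] at hρ
  have nS := nuclearLE_disentangle h h0 h1 hρ hs hk hR hR'
  -- Trace norm `10000 * η ^ 3` yields two factors of size `100 * η ^ (3/2)`.
  obtain ⟨u, v, hu, hv, huv⟩ := nS.exists_bond (Fin 1 × ℕ)
  set τ : ℝ := √(η ^ 3) with hτ
  have hτ0 : 0 ≤ τ := Real.sqrt_nonneg _
  have hτ1 : τ ≤ 1 := Real.sqrt_le_one.2 (pow_le_one₀ h0.le h1)
  have hητ : η ^ 2 ≤ τ := by
    refine Real.le_sqrt_of_sq_le ?_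
    rw [← pow_mul]
    exact hη4
  have hsqrt : √(10000 * η ^ 3) = 100 * τ := by
    rw [Real.sqrt_mul (by norm_num), show (10000 : ℝ) = 100 ^ 2 by norm_num,
      Real.sqrt_sq (by norm_num)]
  rw [hsqrt] at hu hv
  have hCε : 30000 * τ ≤ 30000 * K' ^ 3 * ε ^ (3 / 2 : ℝ) := by linarith
  have hreg := normLE_regroup_sub h h0 h1 hu hv
  have hlead := abs_regroup_zero_sub_one_le (u := u) (v := v) h h0 h1
  refine ⟨B, R, fun x => halfDisc A u (x.1, x.2.1, x.2.2.1) x.2.2.2,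
    fun x => halfDisc (flipVert A) v (x.1, x.2.2.2, x.2.2.1) x.2.1, hBm, ?_, hRB, ?_, ?_,
    joinHalves_halfDisc hu hv huv, ?_, ?_, ?_, ?_, ?_⟩
  · linarith
  · refine (normLE_danger h h0 h1 nS (f := fun i => (0, i)) (fun i hi => by simpa using hi)
      fun i j hij => (Prod.mk.inj hij).2).mono ?_
    linarith
  · refine (normLE_danger h h0 h1 nS (f := fun i => (i, 0)) (fun i hi => by simpa using hi)
      fun i j hij => (Prod.mk.inj hij).1).mono ?_
    linarith
  · exact (NormLE.row_zero (f := rowTensor A A) (normLE_row h h0 h1)).mono (by linarith)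
  · refine ((NormLE.row_zero (f := rowTensor (flipVert A) (flipVert A))
      (normLE_row h.flipVert h0 h1)).comp (g := fun x : ℕ × ℕ × (ℕ × ℕ) => (x.1, x.2.2, x.2.1))
      ?_).mono (by linarith)
    rintro ⟨_, _, _⟩ ⟨_, _, _⟩ h
    simp_all
  · refine (hu.comp (g := fun x : ℕ × (ℕ × ℕ) × ℕ × (Fin 1 × ℕ) =>
      ((x.1, x.2.1, x.2.2.1), x.2.2.2)) ?_).mono (by linarith)
    rintro ⟨_, _, _, _⟩ ⟨_, _, _, _⟩ h
    simp_all
  · refine (hv.comp (g := fun x : ℕ × (Fin 1 × ℕ) × ℕ × (ℕ × ℕ) =>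
      ((x.1, x.2.2.2, x.2.2.1), x.2.1)) ?_).mono (by linarith)
    rintro ⟨_, _, _, _⟩ ⟨_, _, _, _⟩ h
    simp_all
  · intro J Φ hJ hΦ
    constructor
    · rw [contractIso_zero hJ hΦ]
      refine hlead.trans ?_
      nlinarith
    -- With `η ^ 2 ≤ τ ≤ 1` and `η ≤ 1 / 20`, the total `2 * (c + a)` is below `22000 * τ`; the main
    -- term is `(106 * τ) * (2 + 100)`, doubled.
    · refine satisfiesA1_contractIso hJ hΦ hlead (by linarith) hreg (le_trans ?_ hCε)
      nlinarith
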